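/- Let $X,Y$ be random variables with finite alphabets $\mathcal X,\mathcal Y$ and joint p.m.f. $p(x,y)$, and let $(X_i,Y_i)$, $i\ge 1$, be independent drawings of $(X,Y)$; all information quantities are in bits. A rate pair $(R_1,R_2)\in\mathbb R^2$ \emph{enables} a common information rate $R\in\mathbb R$ if for every $\epsilon>0$ there are an integer $n\ge 1$ and functions $f_k:\mathcal X^n\times\mathcal Y^n\to\{1,\dots,\lfloor 2^{n(R_k+\epsilon)}\rfloor\}$ ($k=1,2$), $g_1:\mathcal X^n\times\{1,\dots,\lfloor 2^{n(R_1+\epsilon)}\rfloor\}\to\mathbb Z$ and $g_2:\mathcal Y^n\times\{1,\dots,\lfloor 2^{n(R_2+\epsilon)}\rfloor\}\to\mathbb Z$ such that, with $W_1=g_1(X^n,f_1(X^n,Y^n))$ and $W_2=g_2(Y^n,f_2(X^n,Y^n))$, $$\Pr(W_1\ne W_2)\le\epsilon\quad\text{and}\quad \tfrac1n I(X^n,Y^n;W_1)\ge R-\epsilon .$$ It \emph{enables} a residual dependency rate $R$ if the same holds with the last inequality replaced by $\tfrac1n I(X^n;Y^n\mid W_1)\le R+\epsilon$. Let $\mathcal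 R_{\mathsf{CI}}(R)$ and $\mathcal R_{\mathsf{RD}}(R)$ be the closures of the sets of rate pairs that enable the common information rate $R$ and the residual dependency rate $R$, respectively, and let $$R_{\mathsf{CI-0}}=\sup\{R:(0,0)\in\mathcal R_{\mathsf{CI}}(R)\},\qquad R_{\mathsf{RD-0}}=\inf\{R:(0,0)\in\mathcal R_{\mathsf{RD}}(R)\}.$$ Let $Q'$ be the connected component containing $X$ of the bipartite graph with vertex set $\mathcal X\sqcup\mathcal Y$ and an edge between $x$ and $y$ if and only if $p(x,y)>0$. Call a random variable $Q$ (a function of $(X,Y)$) a \emph{common part} of $(X,Y)$ if there are random variables $X',Y'$ such that $X=(X',Q)$ and $Y=(Y',Q)$, where each equality means that almost surely each side is a function of the other. Then the supremum and the infimum above are over non-empty sets that are bounded above and below, respectively; almost surely $Q'$ is also the connected component containing $Y$; and: 1. $R_{\mathsf{CI-0}}>0$ (or $R_{\mathsf{RD-0}}<I(X;Y)$) only if $Q'$ is a common part of $(X,Y)$, that is, $X=(X',Q')$ and $Y=(Y',Q')$ for some $X',Y'$, with $H(Q')>0$. 2. $R_{\mathsf{CI-0}}=H(Q')$ and $R_{\mathsf{RD-0}}=I(X;Y\mid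 Q')$ (in the case of item 1, and also otherwise, when $R_{\mathsf{CI-0}}=0$ and $R_{\mathsf{RD-0}}=I(X;Y)$). 3. (Gács–Körner.) Call $R\in\mathbb R$ achievable without a genie if for every $\epsilon>0$ there are $n\ge1$, $g_1:\mathcal X^n\to\mathbb Z$ and $g_2:\mathcal Y^n\to\mathbb Z$ with $\Pr(g_1(X^n)\ne g_2(Y^n))\le\epsilon$ and $\frac1n H(g_1(X^n))\ge R-\epsilon$. The supremum of the rates achievable without a genie equals $H(Q')$, which is the largest value of $H(Q)$ over all common parts $Q$ of $(X,Y)$. -/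

import Mathlib

universe u v

namespace AssistedCI

noncomputable section

/-! Random variables on a finite probability space `Ω` with probability weights `p : Ω → ℝ`
are functions on `Ω`. All information quantities are in bits. -/

section Information

variable {Ω : Type*} [Fintype Ω]

open scoped Classical in
/-- The probability of the event `E`. -/
def prob (p : Ω → ℝ) (E : Set Ω) : ℝ := ∑ ω with ω ∈ E, p ω

/-- The probability mass function of the random variable `Z`. -/
def pmfOf {α : Type*} (p : Ω → ℝ) (Z : Ω → α) (z : α) : ℝ := prob p {ω | Z ω = z}

open scoped Classical in
/-- Shannon entropy `H(Z) = -∑ z, P(Z = z) log₂ P(Z = z)`, over the values `z` that `Z` takes. -/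
def entropy {α : Type*} (p : Ω → ℝ) (Z : Ω → α) : ℝ :=
  -∑ z ∈ Finset.univ.image Z, pmfOf p Z z * Real.logb 2 (pmfOf p Z z)

/-- `H(A | B) = H(A, B) - H(B)`. -/
def condEntropy {α β : Type*} (p : Ω → ℝ) (A : Ω → α) (B : Ω → β) : ℝ :=
  entropy p (fun ω => (A ω, B ω)) - entropy p B

/-- `I(A ; B) = H(A) - H(A | B)`. -/
def mutualInfo {α β : Type*} (p : Ω → ℝ) (A : Ω → α) (B : Ω → β) : ℝ :=
  entropy p A - condEntropy p A B

/-- `I(A ; B | C) = H(A | C) - H(A | B, C)`. -/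
def condMutualInfo {α β γ : Type*} (p : Ω → ℝ) (A : Ω → α) (B : Ω → β) (C : Ω → γ) : ℝ :=
  condEntropy p A C - condEntropy p A (fun ω => (B ω, C ω))

/-- `A = B` up to relabelling of values: almost surely each of `A`, `B` is a function of the
other. -/
def SameUpToRelabelling {α β : Type*} (p : Ω → ℝ) (A : Ω → α) (B : Ω → β) : Prop :=
  (∃ e : α → β, ∀ ω, 0 < p ω → B ω = e (A ω)) ∧ (∃ d : β → α, ∀ ω, 0 < p ω → A ω = d (B ω))

end Information

section Source

variable {𝒳 : Type u} {𝒴 : Type v}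

/-- The weights of `n` independent drawings of `(X, Y) ∼ p`. -/
def iid (p : 𝒳 × 𝒴 → ℝ) (n : ℕ) : (Fin n → 𝒳 × 𝒴) → ℝ := fun ω => ∏ i, p (ω i)

/-- `X ^ n`, the first components of the drawings. -/
def seqX {n : ℕ} (ω : Fin n → 𝒳 × 𝒴) : Fin n → 𝒳 := fun i => (ω i).1

/-- `Y ^ n`, the second components of the drawings. -/
def seqY {n : ℕ} (ω : Fin n → 𝒳 × 𝒴) : Fin n → 𝒴 := fun i => (ω i).2

/-- A scheme with block length `n`: the genie's encoders `f₁`, `f₂`, with `M₁` and `M₂` messages,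
and the observers' maps `g₁`, `g₂`. -/
structure Scheme (𝒳 : Type u) (𝒴 : Type v) (n M₁ M₂ : ℕ) where
  f₁ : (Fin n → 𝒳) → (Fin n → 𝒴) → Fin M₁
  f₂ : (Fin n → 𝒳) → (Fin n → 𝒴) → Fin M₂
  g₁ : (Fin n → 𝒳) → Fin M₁ → ℤ
  g₂ : (Fin n → 𝒴) → Fin M₂ → ℤ

/-- The first observer's output `g₁(X^n, f₁(X^n, Y^n))`. -/
def Scheme.out₁ {n M₁ M₂ : ℕ} (c : Scheme 𝒳 𝒴 n M₁ M₂) (ω : Fin n → 𝒳 × 𝒴) : ℤ :=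
  c.g₁ (seqX ω) (c.f₁ (seqX ω) (seqY ω))

/-- The second observer's output `g₂(Y^n, f₂(X^n, Y^n))`. -/
def Scheme.out₂ {n M₁ M₂ : ℕ} (c : Scheme 𝒳 𝒴 n M₁ M₂) (ω : Fin n → 𝒳 × 𝒴) : ℤ :=
  c.g₂ (seqY ω) (c.f₂ (seqX ω) (seqY ω))

/-- The number of messages `⌊2 ^ (n R)⌋` on a link of rate `R` used over block length `n`. -/
def numMessages (n : ℕ) (R : ℝ) : ℕ := ⌊(2 : ℝ) ^ ((n : ℝ) * R)⌋₊

variable [Fintype 𝒳] [Fintype 𝒴]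

/-- The rate pair `r` enables the common information rate `R`. -/
def EnablesCI (p : 𝒳 × 𝒴 → ℝ) (r : ℝ × ℝ) (R : ℝ) : Prop :=
  ∀ ε : ℝ, 0 < ε → ∃ n : ℕ, 0 < n ∧
    ∃ c : Scheme 𝒳 𝒴 n (numMessages n (r.1 + ε)) (numMessages n (r.2 + ε)),
      prob (iid p n) {ω | c.out₁ ω ≠ c.out₂ ω} ≤ ε ∧
      R - ε ≤ 1 / (n : ℝ) * mutualInfo (iid p n) (fun ω => (seqX ω, seqY ω)) c.out₁

/-- The rate pair `r` enables the residual dependency rate `R`. -/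
def EnablesRD (p : 𝒳 × 𝒴 → ℝ) (r : ℝ × ℝ) (R : ℝ) : Prop :=
  ∀ ε : ℝ, 0 < ε → ∃ n : ℕ, 0 < n ∧
    ∃ c : Scheme 𝒳 𝒴 n (numMessages n (r.1 + ε)) (numMessages n (r.2 + ε)),
      prob (iid p n) {ω | c.out₁ ω ≠ c.out₂ ω} ≤ ε ∧
      1 / (n : ℝ) * condMutualInfo (iid p n) seqX seqY c.out₁ ≤ R + ε

/-- The rate region for enabling a common information rate `R`. -/
def rateRegionCI (p : 𝒳 × 𝒴 → ℝ) (R : ℝ) : Set (ℝ × ℝ) := closure {r | EnablesCI p r R}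

/-- The rate region for enabling a residual dependency rate `R`. -/
def rateRegionRD (p : 𝒳 × 𝒴 → ℝ) (R : ℝ) : Set (ℝ × ℝ) := closure {r | EnablesRD p r R}

/-- The common information rates achievable with zero-rate links. -/
def zeroRateCISet (p : 𝒳 × 𝒴 → ℝ) : Set ℝ := {R | (0, 0) ∈ rateRegionCI p R}

/-- The residual dependency rates achievable with zero-rate links. -/
def zeroRateRDSet (p : 𝒳 × 𝒴 → ℝ) : Set ℝ := {R | (0, 0) ∈ rateRegionRD p R}

/-- `R_CI-0`. -/
def RCI0 (p : 𝒳 × 𝒴 → ℝ) : ℝ := sSup (zeroRateCISet p)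

/-- `R_RD-0`. -/
def RRD0 (p : 𝒳 × 𝒴 → ℝ) : ℝ := sInf (zeroRateRDSet p)

/-- `R` is an achievable common information rate in the setup of Gács and Körner, without a
genie. -/
def GKAchievable (p : 𝒳 × 𝒴 → ℝ) (R : ℝ) : Prop :=
  ∀ ε : ℝ, 0 < ε → ∃ n : ℕ, 0 < n ∧ ∃ (g₁ : (Fin n → 𝒳) → ℤ) (g₂ : (Fin n → 𝒴) → ℤ),
    prob (iid p n) {ω | g₁ (seqX ω) ≠ g₂ (seqY ω)} ≤ ε ∧
    R - ε ≤ 1 / (n : ℝ) * entropy (iid p n) (fun ω => g₁ (seqX ω))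

end Source

section Graph

variable {𝒳 : Type u} {𝒴 : Type v}

/-- `Q` is an explicit common part of `(X, Y)`: there are `X'`, `Y'` such that `X = (X', Q)` and
`Y = (Y', Q)`. -/
def IsCommonPart {γ : Type*} (p : 𝒳 × 𝒴 → ℝ) (Q : 𝒳 × 𝒴 → γ) : Prop :=
  ∃ (𝒳' : Type u) (𝒴' : Type v) (X' : 𝒳 × 𝒴 → 𝒳') (Y' : 𝒳 × 𝒴 → 𝒴'),
    SameUpToRelabelling p Prod.fst (fun ω => (X' ω, Q ω)) ∧
    SameUpToRelabelling p Prod.snd (fun ω => (Y' ω, Q ω))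

/-- The bipartite graph on `𝒳 ∪ 𝒴` with an edge between `x` and `y` iff `p(x, y) > 0`. -/
def supportGraph (p : 𝒳 × 𝒴 → ℝ) : SimpleGraph (𝒳 ⊕ 𝒴) :=
  SimpleGraph.fromRel fun a b => ∃ x y, a = Sum.inl x ∧ b = Sum.inr y ∧ 0 < p (x, y)

/-- The connected component of the support graph to which `X` belongs. -/
def componentX (p : 𝒳 × 𝒴 → ℝ) : 𝒳 × 𝒴 → (supportGraph p).ConnectedComponent :=
  fun ω => (supportGraph p).connectedComponentMk (Sum.inl ω.1)

/-- The connected component of the support graph to which `Y` belongs. -/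
def componentY (p : 𝒳 × 𝒴 → ℝ) : 𝒳 × 𝒴 → (supportGraph p).ConnectedComponent :=
  fun ω => (supportGraph p).connectedComponentMk (Sum.inr ω.2)

end Graph

end

end AssistedCI

/-!
Write `K` for the connected component of `(X, Y)` in the support graph. It is a function of `X` and,
almost surely, a function of `Y`, so with block length one and silent links both observers can
output `K`; this achieves the rates `H(K)` and `I(X ; Y | K) = I(X ; Y) - H(K)`, and shows that `K`
is a common part.

For the converse, let `W` be the output of the first observer in a scheme with low link rates and a
low probability of disagreement. Then `H(W | Xⁿ)` and `H(W | Yⁿ)` are at most `n δ` with `δ` small: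
the first is at most the rate of a link, and the second is bounded by the rate of the other link and
Fano's inequality (`condEntropy_out₁_seqY_le`). It remains to see that such a `W` satisfies
`H(W) ≤ n (H(K) + η)`, where `η` is small.

The single-letter reason is the double Markov property. For weights `s` on pairs, supported in the
support of the law `p` of `(X, Y)`, let `D_φ(s)` be the divergence of the conditional law of `s`
given `φ` from that of `p` (`condDiv`). If `D_X(s) = D_Y(s) = 0` then the density of `s` with
respect to `p` is a function of `x` and a function of `y`, hence constant on connected components,
and `D_K(s) = 0` (`condDiv_component_eq_zero`). By compactness, for every `η > 0` there is a
constant `C` with `D_K ≤ η + C (D_X + D_Y)` on probability weights (`exists_condDiv_component_le`).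
Averaged over the values of a random variable `U` this reads
`I(U ; X, Y | K) ≤ η + C (I(U ; X, Y | X) + I(U ; X, Y | Y))`, with `C = C(η, p)`.
Being affine, the estimate can be summed over `i` with `U = (W, (X, Y)ⁱ⁻¹)`; no time-sharing
variable and no bound on the alphabet of `U` are needed. The left side then sums to at least
`H(W) - n H(K)` (`le_sum_condMutualInfo`), and the terms on the right to at most `H(W | Xⁿ)` and
`H(W | Yⁿ)` (`sum_condMutualInfo_le`), which gives `entropy_le_of_condDiv_le`.

The bound on the residual dependency follows from `I(Xⁿ ; Yⁿ | W) ≥ n I(X ; Y) - H(W)`. A scheme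
without a genie is a scheme with silent links, so the bound for the rates achievable without a
genie is a special case. Finally a common part is a function of `X` and of `Y`, so it is constant on
connected components and its entropy is at most `H(K)`.
-/

namespace AssistedCI

noncomputable section

/-! ### Entropy as an expectation -/

section Entropy

variable {Ω α β : Type*} [Fintype Ω]

open scoped Classical in
lemma pmfOf_eq_sum (p : Ω → ℝ) (Z : Ω → α) (a : α) :
    pmfOf p Z a = ∑ ω, if Z ω = a then p ω else 0 := by
  simp [pmfOf, prob, Finset.sum_filter]

lemma pmfOf_nonneg {p : Ω → ℝ} (hp : ∀ ω, 0 ≤ p ω) (Z : Ω → α) (a : α) : 0 ≤ pmfOf p Z a :=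
  Finset.sum_nonneg fun ω _ => hp ω

lemma le_pmfOf {p : Ω → ℝ} (hp : ∀ ω, 0 ≤ p ω) (Z : Ω → α) (ω : Ω) :
    p ω ≤ pmfOf p Z (Z ω) := by
  classical
  rw [pmfOf_eq_sum]
  refine le_trans ?_ (Finset.single_le_sum (f := fun ω' => if Z ω' = Z ω then p ω' else 0)
    (fun i _ => ?_) (Finset.mem_univ ω))
  · simp
  · split_ifs
    exacts [hp i, le_rfl]

lemma pmfOf_pos {p : Ω → ℝ} (hp : ∀ ω, 0 ≤ p ω) (Z : Ω → α) {ω : Ω} (h : 0 < p ω) :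
    0 < pmfOf p Z (Z ω) := h.trans_le (le_pmfOf hp Z ω)

lemma sum_image_pmfOf_mul [DecidableEq α] (p : Ω → ℝ) (Z : Ω → α) (f : α → ℝ) :
    ∑ a ∈ Finset.univ.image Z, pmfOf p Z a * f a = ∑ ω, p ω * f (Z ω) := by
  rw [← Finset.sum_fiberwise_of_maps_to (s := Finset.univ) (t := Finset.univ.image Z) (g := Z)
    (fun ω _ => Finset.mem_image_of_mem _ (Finset.mem_univ ω))]
  refine Finset.sum_congr rfl fun a _ => ?_
  rw [pmfOf, prob, Finset.sum_mul]
  refine Finset.sum_congr (by ext; simp) fun ω hω => ?_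
  rw [(Finset.mem_filter.1 hω).2]

lemma sum_pmfOf_mul [Fintype α] (p : Ω → ℝ) (Z : Ω → α) (f : α → ℝ) :
    ∑ a, pmfOf p Z a * f a = ∑ ω, p ω * f (Z ω) := by
  classical
  simp_rw [pmfOf_eq_sum, Finset.sum_mul, ite_mul, zero_mul]
  rw [Finset.sum_comm]
  simp

/-- Entropy is the expected surprisal; this holds for arbitrary real weights. -/
lemma entropy_eq_sum (p : Ω → ℝ) (Z : Ω → α) :
    entropy p Z = -∑ ω, p ω * Real.logb 2 (pmfOf p Z (Z ω)) := by
  classical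
  rw [entropy, sum_image_pmfOf_mul p Z fun a => Real.logb 2 (pmfOf p Z a)]

/-- If `A` almost surely determines `B`, then `H(B) ≤ H(A)`. -/
lemma entropy_le_entropy {p : Ω → ℝ} (hp : ∀ ω, 0 ≤ p ω) {A : Ω → α} {B : Ω → β}
    (h : ∀ ω ω', 0 < p ω → 0 < p ω' → A ω = A ω' → B ω = B ω') : entropy p B ≤ entropy p A := by
  classical
  rw [entropy_eq_sum, entropy_eq_sum, neg_le_neg_iff]
  refine Finset.sum_le_sum fun ω _ => ?_
  rcases (hp ω).eq_or_lt with h0 | h0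
  · simp [← h0]
  refine mul_le_mul_of_nonneg_left ?_ (hp ω)
  refine Real.logb_le_logb_of_le one_lt_two (pmfOf_pos hp A h0) ?_
  rw [pmfOf_eq_sum, pmfOf_eq_sum]
  refine Finset.sum_le_sum fun ω' _ => ?_
  rcases (hp ω').eq_or_lt with h1 | h1
  · simp [← h1]
  by_cases hA : A ω' = A ω
  · rw [if_pos hA, if_pos (h _ _ h1 h0 hA)]
  · rw [if_neg hA]; split_ifs
    exacts [h1.le, le_rfl]

lemma entropy_congr {p : Ω → ℝ} (hp : ∀ ω, 0 ≤ p ω) {A : Ω → α} {B : Ω → β}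
    (h : ∀ ω ω', 0 < p ω → 0 < p ω' → (A ω = A ω' ↔ B ω = B ω')) : entropy p A = entropy p B :=
  le_antisymm (entropy_le_entropy hp fun ω ω' h1 h2 => (h ω ω' h1 h2).2)
    (entropy_le_entropy hp fun ω ω' h1 h2 => (h ω ω' h1 h2).1)

lemma pmfOf_pmfOf [Fintype α] (p : Ω → ℝ) (Z : Ω → α) (φ : α → β) (b : β) :
    pmfOf (pmfOf p Z) φ b = pmfOf p (fun ω => φ (Z ω)) b := by
  classical
  have := sum_pmfOf_mul p Z fun a => if φ a = b then 1 else 0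
  simpa [pmfOf_eq_sum _ φ, pmfOf_eq_sum _ (fun ω => φ (Z ω))] using this

lemma entropy_pmfOf [Fintype α] (p : Ω → ℝ) (Z : Ω → α) (φ : α → β) :
    entropy (pmfOf p Z) φ = entropy p (fun ω => φ (Z ω)) := by
  rw [entropy_eq_sum, entropy_eq_sum]
  simp_rw [pmfOf_pmfOf]
  rw [sum_pmfOf_mul p Z fun a => Real.logb 2 (pmfOf p (fun ω => φ (Z ω)) (φ a))]

lemma continuous_entropy (Z : Ω → α) : Continuous fun p : Ω → ℝ => entropy p Z := by
  classical
  have h (z : α) : Continuous fun p : Ω → ℝ => pmfOf p Z z := by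
    simp_rw [pmfOf, prob]
    fun_prop
  simp_rw [entropy, Real.logb, ← mul_div_assoc]
  exact (continuous_finsetSum _ fun z _ => (Real.continuous_mul_log.comp (h z)).div_const _).neg

lemma pmfOf_smul (p : Ω → ℝ) (c : ℝ) (Z : Ω → α) (a : α) :
    pmfOf (fun ω => c * p ω) Z a = c * pmfOf p Z a := by
  simp [pmfOf, prob, Finset.mul_sum]

lemma entropy_smul {p : Ω → ℝ} (hp : ∀ ω, 0 ≤ p ω) {c : ℝ} (hc : c ≠ 0) (Z : Ω → α) :
    entropy (fun ω => c * p ω) Z = c * entropy p Z - c * Real.logb 2 c * ∑ ω, p ω := by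
  rw [entropy_eq_sum, entropy_eq_sum, mul_neg, Finset.mul_sum, Finset.mul_sum, ← neg_add',
    ← Finset.sum_add_distrib]
  congr 1
  refine Finset.sum_congr rfl fun ω _ => ?_
  rcases (hp ω).eq_or_lt with h0 | h0
  · simp [← h0]
  rw [pmfOf_smul, Real.logb_mul hc (pmfOf_pos hp Z h0).ne']
  ring

end Entropy

/-! ### Conditional divergence -/

section Divergence

variable {Ω α β 𝒵 : Type*} [Fintype Ω] [Fintype 𝒵]

/-- The conditional divergence `D(s_{Z | φ(Z)} ‖ p_{Z | φ(Z)} | s_{φ(Z)})` of the weights `s` from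
the weights `p`. It is written with entropies, which makes its continuity in `s` evident, and it is
homogeneous of degree one in `s`, so that `s` need not be normalised. -/
def condDiv (p : 𝒵 → ℝ) (φ : 𝒵 → α) (s : 𝒵 → ℝ) : ℝ :=
  entropy s φ - entropy s id + ∑ z, s z * (Real.logb 2 (pmfOf p φ (φ z)) - Real.logb 2 (p z))

lemma continuous_condDiv (p : 𝒵 → ℝ) (φ : 𝒵 → α) : Continuous (condDiv p φ) :=
  ((continuous_entropy φ).sub (continuous_entropy id)).add (by fun_prop)

lemma condDiv_smul (p : 𝒵 → ℝ) (φ : 𝒵 → α) {s : 𝒵 → ℝ} (hs : ∀ z, 0 ≤ s z) {c : ℝ}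
    (hc : c ≠ 0) : condDiv p φ (fun z => c * s z) = c * condDiv p φ s := by
  simp_rw [condDiv, entropy_smul hs hc, mul_assoc]
  rw [← Finset.mul_sum]
  ring

lemma pmfOf_id (s : 𝒵 → ℝ) (z : 𝒵) : pmfOf s id z = s z := by
  classical simp [pmfOf_eq_sum]

/-- The conditional divergence as the divergence of `s` from the weights that have the marginal of
`s` on `φ(Z)` and the conditional law of `p` given `φ(Z)`. -/
lemma condDiv_eq_sum {p s : 𝒵 → ℝ} (hp : ∀ z, 0 ≤ p z) (hs : ∀ z, 0 ≤ s z)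
    (hsp : ∀ z, p z = 0 → s z = 0) (φ : 𝒵 → α) :
    condDiv p φ s * Real.log 2 = ∑ z, pmfOf s φ (φ z) * p z / pmfOf p φ (φ z) *
      InformationTheory.klFun (s z / (pmfOf s φ (φ z) * p z / pmfOf p φ (φ z))) := by
  classical
  -- the comparison weights have the same total mass as `s`
  have hmass : ∑ z, pmfOf s φ (φ z) * p z / pmfOf p φ (φ z) = ∑ z, s z := by
    have h1 := sum_image_pmfOf_mul p φ fun a => pmfOf s φ a / pmfOf p φ a
    have h2 := sum_image_pmfOf_mul s φ fun _ => 1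
    simp only [mul_one] at h2
    rw [← h2]
    refine Eq.trans (Eq.trans (Finset.sum_congr rfl fun z _ => by ring) h1.symm) ?_
    refine Finset.sum_congr rfl fun a _ => ?_
    by_cases h0 : pmfOf p φ a = 0
    · have : pmfOf s φ a = 0 := by
        rw [pmfOf_eq_sum] at h0 ⊢
        rw [Finset.sum_eq_zero_iff_of_nonneg
          (fun z _ => by split_ifs; exacts [hp z, le_rfl])] at h0
        refine Finset.sum_eq_zero fun z hz => ?_
        have := h0 z hz
        split_ifs at this ⊢ with h
        exacts [hsp z this, rfl]
      rw [this, h0]; ring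
    · field_simp
  have hterm : ∀ z, pmfOf s φ (φ z) * p z / pmfOf p φ (φ z) *
      InformationTheory.klFun (s z / (pmfOf s φ (φ z) * p z / pmfOf p φ (φ z))) =
      (s z * (Real.logb 2 (s z) - Real.logb 2 (pmfOf s φ (φ z)) +
        (Real.logb 2 (pmfOf p φ (φ z)) - Real.logb 2 (p z)))) * Real.log 2 +
      (pmfOf s φ (φ z) * p z / pmfOf p φ (φ z) - s z) := by
    intro z
    rcases (hs z).eq_or_lt with h0 | h0
    · simp [← h0, InformationTheory.klFun]
    have hpz : 0 < p z := (hp z).lt_of_ne fun h => h0.ne' (hsp z h.symm)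
    have h1 := pmfOf_pos hp φ hpz
    have h2 := pmfOf_pos hs φ h0
    have hl : Real.log 2 ≠ 0 := (Real.log_pos one_lt_two).ne'
    rw [InformationTheory.klFun, Real.log_div h0.ne' (by positivity),
      Real.log_div (by positivity) h1.ne', Real.log_mul h2.ne' hpz.ne']
    simp only [Real.logb]
    field_simp
    ring
  rw [Finset.sum_congr rfl fun z _ => hterm z, Finset.sum_add_distrib, Finset.sum_sub_distrib,
    hmass, sub_self, add_zero, ← Finset.sum_mul, condDiv, entropy_eq_sum, entropy_eq_sum]
  congr 1
  simp only [pmfOf_id, id_eq, mul_add, mul_sub, Finset.sum_add_distrib, Finset.sum_sub_distrib]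
  ring

lemma condDiv_nonneg {p s : 𝒵 → ℝ} (hp : ∀ z, 0 ≤ p z) (hs : ∀ z, 0 ≤ s z)
    (hsp : ∀ z, p z = 0 → s z = 0) (φ : 𝒵 → α) : 0 ≤ condDiv p φ s := by
  refine nonneg_of_mul_nonneg_left ?_ (Real.log_pos one_lt_two)
  rw [condDiv_eq_sum hp hs hsp]
  refine Finset.sum_nonneg fun z _ => ?_
  have h : 0 ≤ pmfOf s φ (φ z) * p z / pmfOf p φ (φ z) :=
    div_nonneg (mul_nonneg (pmfOf_nonneg hs _ _) (hp z)) (pmfOf_nonneg hp _ _)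
  exact mul_nonneg h (InformationTheory.klFun_nonneg (div_nonneg (hs z) h))

lemma condDiv_eq_zero_iff {p s : 𝒵 → ℝ} (hp : ∀ z, 0 ≤ p z) (hs : ∀ z, 0 ≤ s z)
    (hsp : ∀ z, p z = 0 → s z = 0) (φ : 𝒵 → α) :
    condDiv p φ s = 0 ↔ ∀ z, s z = pmfOf s φ (φ z) * p z / pmfOf p φ (φ z) := by
  have ht (z : 𝒵) : 0 ≤ pmfOf s φ (φ z) * p z / pmfOf p φ (φ z) :=
    div_nonneg (mul_nonneg (pmfOf_nonneg hs _ _) (hp z)) (pmfOf_nonneg hp _ _)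
  rw [← mul_eq_zero_iff_right (Real.log_pos one_lt_two).ne', condDiv_eq_sum hp hs hsp,
    Finset.sum_eq_zero_iff_of_nonneg fun z _ =>
      mul_nonneg (ht z) (InformationTheory.klFun_nonneg (div_nonneg (hs z) (ht z)))]
  simp only [Finset.mem_univ, true_imp_iff]
  refine forall_congr' fun z => ?_
  rw [mul_eq_zero, InformationTheory.klFun_eq_zero_iff (div_nonneg (hs z) (ht z))]
  constructor
  · rintro (h | h)
    · rw [h]
      by_contra h0
      have h0 : 0 < s z := (hs z).lt_of_ne fun h => h0 h.symm
      have hpz : 0 < p z := (hp z).lt_of_ne fun h => h0.ne' (hsp z h.symm)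
      have h1 := pmfOf_pos hp φ hpz
      have h2 := pmfOf_pos hs φ h0
      exact absurd h (by positivity)
    · by_cases h0 : pmfOf s φ (φ z) * p z / pmfOf p φ (φ z) = 0
      · rw [h0, div_zero] at h
        exact absurd h zero_ne_one
      · exact (div_eq_one_iff_eq h0).1 h
  · intro h
    rw [← h]
    by_cases h0 : s z = 0
    · exact Or.inl h0
    · exact Or.inr (div_self h0)

/-- The joint weights of `Z` and the event `U = u`. -/
def slice (P : Ω → ℝ) (Z : Ω → 𝒵) (U : Ω → β) (u : β) (z : 𝒵) : ℝ :=
  pmfOf P (fun ω => (Z ω, U ω)) (z, u)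

lemma pmfOf_slice (P : Ω → ℝ) (Z : Ω → 𝒵) (U : Ω → β) (u : β) (φ : 𝒵 → α) (a : α) :
    pmfOf (slice P Z U u) φ a = pmfOf P (fun ω => (φ (Z ω), U ω)) (a, u) := by
  classical
  simp_rw [pmfOf_eq_sum, slice, pmfOf_eq_sum, Prod.mk.injEq]
  rw [Finset.sum_congr rfl fun z _ => (show _ = ∑ ω, if Z ω = z then
    (if φ (Z ω) = a ∧ U ω = u then P ω else 0) else 0 from ?_), Finset.sum_comm]
  · simp
  · by_cases h : φ z = a
    · rw [if_pos h]
      refine Finset.sum_congr rfl fun ω _ => ?_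
      by_cases h' : Z ω = z
      · subst h'; simp [h]
      · simp [h']
    · rw [if_neg h]
      refine (Finset.sum_eq_zero fun ω _ => ?_).symm
      by_cases h' : Z ω = z
      · subst h'; simp [h]
      · simp [h']

lemma sum_slice [Fintype β] (P : Ω → ℝ) (Z : Ω → 𝒵) (U : Ω → β) (f : 𝒵 → β → ℝ) :
    ∑ u, ∑ z, slice P Z U u z * f z u = ∑ ω, P ω * f (Z ω) (U ω) := by
  rw [← sum_pmfOf_mul P (fun ω => (Z ω, U ω)) fun x => f x.1 x.2, Fintype.sum_prod_type_right]
  rfl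

lemma sum_entropy_slice [Fintype β] (P : Ω → ℝ) (Z : Ω → 𝒵) (U : Ω → β) (φ : 𝒵 → α) :
    ∑ u, entropy (slice P Z U u) φ = entropy P (fun ω => (φ (Z ω), U ω)) := by
  simp_rw [entropy_eq_sum, pmfOf_slice, Finset.sum_neg_distrib]
  rw [sum_slice P Z U fun z u => Real.logb 2 (pmfOf P (fun ω => (φ (Z ω), U ω)) (φ z, u))]

/-- `I(U ; Z | φ(Z))` is the conditional divergence of the law of `Z` given `U` from its
unconditional law, averaged over `U`. -/
lemma sum_condDiv_slice [Fintype β] (P : Ω → ℝ) (Z : Ω → 𝒵) (U : Ω → β) (φ : 𝒵 → α) :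
    ∑ u, condDiv (pmfOf P Z) φ (slice P Z U u) =
      entropy P Z - entropy P (fun ω => φ (Z ω)) - entropy P (fun ω => (Z ω, U ω)) +
        entropy P (fun ω => (φ (Z ω), U ω)) := by
  simp_rw [condDiv, Finset.sum_add_distrib, Finset.sum_sub_distrib, sum_entropy_slice]
  rw [sum_slice P Z U fun z _ => Real.logb 2 (pmfOf (pmfOf P Z) φ (φ z)) -
    Real.logb 2 (pmfOf P Z z), entropy_eq_sum P Z, entropy_eq_sum P fun ω => φ (Z ω)]
  simp_rw [pmfOf_pmfOf, mul_sub, Finset.sum_sub_distrib, id]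
  ring

lemma slice_nonneg {𝒵 : Type*} {P : Ω → ℝ} (hP : ∀ ω, 0 ≤ P ω) (Z : Ω → 𝒵) (U : Ω → β)
    (u : β) (z : 𝒵) : 0 ≤ slice P Z U u z := pmfOf_nonneg hP _ _

lemma slice_eq_zero {𝒵 : Type*} {P : Ω → ℝ} (hP : ∀ ω, 0 ≤ P ω) (Z : Ω → 𝒵) (U : Ω → β)
    (u : β) (z : 𝒵) (h : pmfOf P Z z = 0) : slice P Z U u z = 0 := by
  classical
  rw [pmfOf_eq_sum, Finset.sum_eq_zero_iff_of_nonneg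
    (fun ω _ => by split_ifs; exacts [hP ω, le_rfl])] at h
  rw [slice, pmfOf_eq_sum]
  refine Finset.sum_eq_zero fun ω hω => ?_
  have := h ω hω
  split_ifs at this ⊢ with h1 h2 h2
  · exact this
  · exact absurd (congrArg Prod.fst h1) h2
  · rfl
  · rfl

end Divergence

/-! ### Submodularity of entropy -/

section Submodularity

variable {Ω α β γ : Type*} [Fintype Ω]

/-- Every random variable can be relabelled to take values in the sample space. As entropies depend
only on the induced partitions, this reduces statements about arbitrary alphabets to finite ones. -/
lemma exists_relabelling {Ω : Type*} (A : Ω → α) :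
    ∃ A' : Ω → Ω, ∀ ω ω', A' ω = A' ω' ↔ A ω = A ω' := by
  classical
  refine ⟨fun ω => (⟨ω, rfl⟩ : ∃ x, A x = A ω).choose, fun ω ω' => ⟨fun h => ?_, fun h => ?_⟩⟩
  · rw [← (⟨ω, rfl⟩ : ∃ x, A x = A ω).choose_spec, ← (⟨ω', rfl⟩ : ∃ x, A x = A ω').choose_spec]
    exact congrArg A h
  · simp only [h]

/-- Submodularity of entropy: `I(A ; B | C) ≥ 0`, as this is an average of conditional divergences
of the pair `(A, C)` given its second component. -/
lemma entropy_submodular {P : Ω → ℝ} (hP : ∀ ω, 0 ≤ P ω) (A : Ω → α) (B : Ω → β) (C : Ω → γ) :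
    entropy P (fun ω => (A ω, B ω, C ω)) + entropy P C ≤
      entropy P (fun ω => (A ω, C ω)) + entropy P (fun ω => (B ω, C ω)) := by
  obtain ⟨A', hA⟩ := exists_relabelling A
  obtain ⟨B', hB⟩ := exists_relabelling B
  obtain ⟨C', hC⟩ := exists_relabelling C
  have h := sum_condDiv_slice P (fun ω => (A' ω, C' ω)) B' Prod.snd
  have h0 : 0 ≤ ∑ u, condDiv (pmfOf P fun ω => (A' ω, C' ω)) Prod.snd
      (slice P (fun ω => (A' ω, C' ω)) B' u) :=
    Finset.sum_nonneg fun u _ => condDiv_nonneg (pmfOf_nonneg hP _) (slice_nonneg hP _ _ u)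
      (slice_eq_zero hP _ _ u) _
  have e1 : entropy P (fun ω => ((A' ω, C' ω), B' ω)) = entropy P (fun ω => (A ω, B ω, C ω)) :=
    entropy_congr hP fun ω ω' _ _ => by simp only [Prod.mk.injEq, hA, hB, hC]; tauto
  have e2 : entropy P C' = entropy P C := entropy_congr hP fun ω ω' _ _ => hC ω ω'
  have e3 : entropy P (fun ω => (A' ω, C' ω)) = entropy P (fun ω => (A ω, C ω)) :=
    entropy_congr hP fun ω ω' _ _ => by simp only [Prod.mk.injEq, hA, hC]
  have e4 : entropy P (fun ω => (C' ω, B' ω)) = entropy P (fun ω => (B ω, C ω)) :=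
    entropy_congr hP fun ω ω' _ _ => by simp only [Prod.mk.injEq, hB, hC]; tauto
  simp only [e1, e2, e3, e4] at h
  linarith

lemma entropy_pair_le {P : Ω → ℝ} (hP : P ∈ stdSimplex ℝ Ω) (A : Ω → α) (B : Ω → β) :
    entropy P (fun ω => (A ω, B ω)) ≤ entropy P A + entropy P B := by
  have h := entropy_submodular hP.1 A B fun _ => ()
  have e0 : entropy P (fun _ => ()) = 0 := by
    classical
    have (x : Unit) : pmfOf P (fun _ => ()) x = 1 := by simp [pmfOf_eq_sum, hP.2]
    simp [entropy_eq_sum, this]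
  have e1 : entropy P (fun ω => (A ω, B ω, ())) = entropy P (fun ω => (A ω, B ω)) :=
    entropy_congr hP.1 fun ω ω' _ _ => by simp
  have e2 : entropy P (fun ω => (A ω, ())) = entropy P A :=
    entropy_congr hP.1 fun ω ω' _ _ => by simp
  have e3 : entropy P (fun ω => (B ω, ())) = entropy P B :=
    entropy_congr hP.1 fun ω ω' _ _ => by simp
  linarith

end Submodularity

/-! ### The connected components of the support -/

section Component

variable {𝒳 : Type u} {𝒴 : Type v}

/-- A label of the vertices that agrees across every edge is constant on connected components. -/
lemma eq_of_component_eq {τ : Type*} (p : 𝒳 × 𝒴 → ℝ) {f : 𝒳 → τ} {g : 𝒴 → τ}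
    (hfg : ∀ ω, 0 < p ω → f ω.1 = g ω.2) {ω ω' : 𝒳 × 𝒴}
    (h : componentX p ω = componentX p ω') : f ω.1 = f ω'.1 := by
  have hadj (a b : 𝒳 ⊕ 𝒴) (hab : (supportGraph p).Adj a b) : Sum.elim f g a = Sum.elim f g b := by
    rw [supportGraph, SimpleGraph.fromRel_adj] at hab
    rcases hab.2 with ⟨x, y, rfl, rfl, hxy⟩ | ⟨x, y, rfl, rfl, hxy⟩
    · exact hfg (x, y) hxy
    · exact (hfg (x, y) hxy).symm
  obtain ⟨w⟩ := SimpleGraph.ConnectedComponent.exact h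
  have hw : ∀ {a b : 𝒳 ⊕ 𝒴}, (supportGraph p).Walk a b → Sum.elim f g a = Sum.elim f g b := by
    intro a b w
    induction w with
    | nil => rfl
    | cons hab _ ih => exact (hadj _ _ hab).trans ih
  exact hw w

lemma componentX_eq_componentY (p : 𝒳 × 𝒴 → ℝ) {ω : 𝒳 × 𝒴} (h : 0 < p ω) :
    componentX p ω = componentY p ω := by
  refine SimpleGraph.ConnectedComponent.sound (SimpleGraph.Adj.reachable ?_)
  rw [supportGraph, SimpleGraph.fromRel_adj]
  exact ⟨by simp, Or.inl ⟨_, _, rfl, rfl, h⟩⟩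

variable [Fintype 𝒳] [Fintype 𝒴]

/-- The double Markov property: weights with the conditional laws of `p` given `X` and given `Y`
have the conditional law of `p` given the connected component, as their density with respect to
`p` is both a function of `X` and a function of `Y`. -/
lemma condDiv_component_eq_zero {p s : 𝒳 × 𝒴 → ℝ} (hp : ∀ z, 0 ≤ p z) (hs : ∀ z, 0 ≤ s z)
    (hsp : ∀ z, p z = 0 → s z = 0) (hX : condDiv p Prod.fst s = 0)
    (hY : condDiv p Prod.snd s = 0) : condDiv p (componentX p) s = 0 := by
  classical
  rw [condDiv_eq_zero_iff hp hs hsp] at hX hY ⊢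
  have hX' (z : 𝒳 × 𝒴) : s z = pmfOf s Prod.fst z.1 / pmfOf p Prod.fst z.1 * p z := by
    rw [div_mul_eq_mul_div]; exact hX z
  have hY' (z : 𝒳 × 𝒴) : s z = pmfOf s Prod.snd z.2 / pmfOf p Prod.snd z.2 * p z := by
    rw [div_mul_eq_mul_div]; exact hY z
  intro z
  rcases (hp z).eq_or_lt with h0 | h0
  · rw [hsp z h0.symm, ← h0]; simp
  have hK : pmfOf s (componentX p) (componentX p z) =
      pmfOf s Prod.fst z.1 / pmfOf p Prod.fst z.1 * pmfOf p (componentX p) (componentX p z) := by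
    rw [pmfOf_eq_sum s (componentX p), pmfOf_eq_sum p (componentX p), Finset.mul_sum]
    refine Finset.sum_congr rfl fun z' _ => ?_
    split_ifs with h
    · rw [hX' z', eq_of_component_eq p (f := fun x => pmfOf s Prod.fst x / pmfOf p Prod.fst x)
        (g := fun y => pmfOf s Prod.snd y / pmfOf p Prod.snd y)
        (fun ω hω => mul_right_cancel₀ hω.ne' ((hX' ω).symm.trans (hY' ω))) h]
    · simp
  have h1 := (pmfOf_pos hp (componentX p) h0).ne'
  rw [hK, mul_right_comm, mul_div_cancel_right₀ _ h1]
  exact hX' z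

end Component

/-! ### Almost conditional independence forces almost functional dependence -/

/-- If `F ≤ 0` wherever `G ≥ 0` vanishes on a compact set, then `F` is bounded by a multiple of `G`
up to an arbitrarily small constant. -/
lemma _root_.IsCompact.exists_le_add_mul {E : Type*} [TopologicalSpace E] {S : Set E}
    (hS : IsCompact S) {F G : E → ℝ} (hF : Continuous F) (hG : Continuous G)
    (hG0 : ∀ s ∈ S, 0 ≤ G s) (hFG : ∀ s ∈ S, G s = 0 → F s ≤ 0) {η : ℝ} (hη : 0 < η) :
    ∃ C, 0 ≤ C ∧ ∀ s ∈ S, F s ≤ η + C * G s := by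
  have hT : IsCompact (S ∩ {s | η ≤ F s}) :=
    hS.inter_right (isClosed_le continuous_const hF)
  rcases (S ∩ {s | η ≤ F s}).eq_empty_or_nonempty with h | h
  · refine ⟨0, le_rfl, fun s hs => ?_⟩
    by_contra! hlt
    exact (h ▸ (⟨hs, by simp at hlt; exact hlt.le⟩ : s ∈ S ∩ {s | η ≤ F s}) : s ∈ (∅ : Set E))
  obtain ⟨s₀, hs₀, hmin⟩ := hT.exists_isMinOn h hG.continuousOn
  obtain ⟨s₁, hs₁, hmax⟩ := hT.exists_isMaxOn h hF.continuousOn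
  have hpos : 0 < G s₀ := (hG0 s₀ hs₀.1).lt_of_ne fun h0 =>
    absurd (hFG s₀ hs₀.1 h0.symm) (not_le.2 (hη.trans_le hs₀.2))
  have hF1 : 0 < F s₁ := hη.trans_le hs₁.2
  refine ⟨F s₁ / G s₀, by positivity, fun s hs => ?_⟩
  rcases le_or_gt η (F s) with hs' | hs'
  · have h1 : F s ≤ F s₁ := hmax ⟨hs, hs'⟩
    have h2 : G s₀ ≤ G s := hmin ⟨hs, hs'⟩
    have h3 : F s₁ ≤ F s₁ / G s₀ * G s := by
      rw [div_mul_eq_mul_div, le_div_iff₀ hpos]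
      exact mul_le_mul_of_nonneg_left h2 hF1.le
    linarith
  · have := hG0 s hs
    have : 0 ≤ F s₁ / G s₀ * G s := by positivity
    linarith

section SingleLetter

variable {𝒳 : Type u} {𝒴 : Type v} [Fintype 𝒳] [Fintype 𝒴]

/-- The double Markov property in quantitative form, from the exact one by compactness of the set of
probability weights supported in the support of `p`. -/
lemma exists_condDiv_component_le {p : 𝒳 × 𝒴 → ℝ} (hp : ∀ z, 0 ≤ p z) {η : ℝ} (hη : 0 < η) :
    ∃ C, 0 ≤ C ∧ ∀ s : 𝒳 × 𝒴 → ℝ, (∀ z, 0 ≤ s z) → (∀ z, p z = 0 → s z = 0) →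
      condDiv p (componentX p) s ≤
        η * ∑ z, s z + C * (condDiv p Prod.fst s + condDiv p Prod.snd s) := by
  have hclosed : IsClosed {s : 𝒳 × 𝒴 → ℝ | ∀ z, p z = 0 → s z = 0} := by
    simp only [Set.ofPred_forall]
    exact isClosed_iInter fun z => isClosed_iInter fun _ =>
      isClosed_eq (continuous_apply z) continuous_const
  obtain ⟨C, hC, h⟩ := ((isCompact_stdSimplex ℝ (𝒳 × 𝒴)).inter_right hclosed).exists_le_add_mul
    (continuous_condDiv p (componentX p))
    ((continuous_condDiv p Prod.fst).add (continuous_condDiv p Prod.snd))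
    (fun s hs => add_nonneg (condDiv_nonneg hp hs.1.1 hs.2 _) (condDiv_nonneg hp hs.1.1 hs.2 _))
    (fun s hs h0 => by
      have h1 := condDiv_nonneg hp hs.1.1 hs.2 Prod.fst
      have h2 := condDiv_nonneg hp hs.1.1 hs.2 Prod.snd
      simp only [Pi.add_apply] at h0
      exact (condDiv_component_eq_zero hp hs.1.1 hs.2 (by linarith) (by linarith)).le) hη
  refine ⟨C, hC, fun s hs hsp => ?_⟩
  -- both sides are homogeneous of degree one, which reduces to total mass one
  rcases (Finset.sum_nonneg fun z (_ : z ∈ Finset.univ) => hs z).eq_or_lt with h0 | h0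
  · have : s = 0 := funext fun z =>
      (Finset.sum_eq_zero_iff_of_nonneg fun z _ => hs z).1 h0.symm z (Finset.mem_univ z)
    subst this
    simp [condDiv, entropy_eq_sum]
  · have hmem : (fun z => (∑ z, s z)⁻¹ * s z) ∈
        stdSimplex ℝ (𝒳 × 𝒴) ∩ {s | ∀ z, p z = 0 → s z = 0} := by
      refine ⟨⟨fun z => mul_nonneg (inv_nonneg.2 h0.le) (hs z), ?_⟩, fun z hz => ?_⟩
      · rw [← Finset.mul_sum, inv_mul_cancel₀ h0.ne']
      · simp only [hsp z hz, mul_zero]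
    have := h _ hmem
    simp only [Pi.add_apply, condDiv_smul p _ hs (inv_ne_zero h0.ne')] at this
    have := mul_le_mul_of_nonneg_left this h0.le
    field_simp at this
    linarith

/-- The single-letter estimate
`I(U ; X, Y | K) ≤ η + C (I(U ; X, Y | X) + I(U ; X, Y | Y))`, where `K` is the connected component
of `(X, Y)`: the divergence bound of the hypothesis, averaged over the values of `U`. -/
lemma condMutualInfo_component_le {p : 𝒳 × 𝒴 → ℝ} {η C : ℝ}
    (h : ∀ s : 𝒳 × 𝒴 → ℝ, (∀ z, 0 ≤ s z) → (∀ z, p z = 0 → s z = 0) →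
      condDiv p (componentX p) s ≤
        η * ∑ z, s z + C * (condDiv p Prod.fst s + condDiv p Prod.snd s))
    {Ω β : Type*} [Fintype Ω] {P : Ω → ℝ} (hP : P ∈ stdSimplex ℝ Ω) {Z : Ω → 𝒳 × 𝒴}
    (hZ : pmfOf P Z = p) (U : Ω → β) :
    entropy P Z - entropy P (fun ω => componentX p (Z ω)) - entropy P (fun ω => (Z ω, U ω)) +
        entropy P (fun ω => (componentX p (Z ω), U ω)) ≤
      η + C * ((entropy P Z - entropy P (fun ω => (Z ω).1) - entropy P (fun ω => (Z ω, U ω)) +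
        entropy P (fun ω => ((Z ω).1, U ω))) +
        (entropy P Z - entropy P (fun ω => (Z ω).2) - entropy P (fun ω => (Z ω, U ω)) +
        entropy P (fun ω => ((Z ω).2, U ω)))) := by
  obtain ⟨U', hU⟩ := exists_relabelling U
  have e1 : entropy P (fun ω => (Z ω, U ω)) = entropy P (fun ω => (Z ω, U' ω)) :=
    entropy_congr hP.1 fun ω ω' _ _ => by simp only [Prod.mk.injEq, hU]
  have e2 : entropy P (fun ω => (componentX p (Z ω), U ω)) =
      entropy P (fun ω => (componentX p (Z ω), U' ω)) :=
    entropy_congr hP.1 fun ω ω' _ _ => by simp only [Prod.mk.injEq, hU]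
  have e3 : entropy P (fun ω => ((Z ω).1, U ω)) = entropy P (fun ω => ((Z ω).1, U' ω)) :=
    entropy_congr hP.1 fun ω ω' _ _ => by simp only [Prod.mk.injEq, hU]
  have e4 : entropy P (fun ω => ((Z ω).2, U ω)) = entropy P (fun ω => ((Z ω).2, U' ω)) :=
    entropy_congr hP.1 fun ω ω' _ _ => by simp only [Prod.mk.injEq, hU]
  rw [e1, e2, e3, e4, ← sum_condDiv_slice, ← sum_condDiv_slice, ← sum_condDiv_slice, hZ,
    ← Finset.sum_add_distrib, Finset.mul_sum]
  have hmass : ∑ u, ∑ z, slice P Z U' u z = 1 := by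
    simpa [hP.2] using sum_slice P Z U' fun _ _ => 1
  have hη : η = ∑ u, η * ∑ z, slice P Z U' u z := by rw [← Finset.mul_sum, hmass, mul_one]
  rw [hη, ← Finset.sum_add_distrib]
  exact Finset.sum_le_sum fun u _ => h _ (slice_nonneg hP.1 _ _ u)
    fun z hz => slice_eq_zero hP.1 _ _ u z (hZ ▸ hz)

end SingleLetter

/-! ### Independent drawings and single-letterisation -/

section Block

variable {𝒳 : Type u} {𝒴 : Type v} [Fintype 𝒳] [Fintype 𝒴] {p : 𝒳 × 𝒴 → ℝ} {n : ℕ}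

lemma iid_mem_stdSimplex (hp : p ∈ stdSimplex ℝ (𝒳 × 𝒴)) (n : ℕ) :
    iid p n ∈ stdSimplex ℝ (Fin n → 𝒳 × 𝒴) := by
  classical
  refine ⟨fun ω => Finset.prod_nonneg fun i _ => hp.1 _, ?_⟩
  simp only [iid]
  rw [← Fintype.prod_sum (fun _ z => p z)]
  simp [hp.2]

lemma pmfOf_iid_comp (n : ℕ) {α : Type*} (φ : 𝒳 × 𝒴 → α) (a : Fin n → α) :
    pmfOf (iid p n) (fun ω i => φ (ω i)) a = ∏ i, pmfOf p φ (a i) := by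
  classical
  simp_rw [pmfOf_eq_sum, Fintype.prod_sum, iid, funext_iff]
  refine Finset.sum_congr rfl fun ω _ => ?_
  rw [Finset.prod_ite_zero]
  simp

lemma pmfOf_iid_apply (hp : p ∈ stdSimplex ℝ (𝒳 × 𝒴)) (i : Fin n) :
    pmfOf (iid p n) (fun ω => ω i) = p := by
  classical
  funext z
  -- the marginal at `i` as a product of sums: the factor at `i` is `p z`, the others are `1`
  have h := Fintype.prod_sum (fun (j : Fin n) z' =>
    if j = i then (if z' = z then p z' else 0) else p z')
  rw [Finset.prod_eq_single i (fun j _ hj => by simp [hj, hp.2]) (by simp)] at h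
  simp only [if_true, Finset.sum_ite_eq', Finset.mem_univ] at h
  rw [h, pmfOf_eq_sum]
  refine Finset.sum_congr rfl fun ω _ => ?_
  by_cases h1 : ω i = z
  · rw [if_pos h1]
    exact Finset.prod_congr rfl fun j _ => by
      split_ifs with h2 h3 <;> first | rfl | (subst h2; exact absurd h1 h3)
  · rw [if_neg h1]
    exact (Finset.prod_eq_zero (Finset.mem_univ i) (by simp [h1])).symm

lemma entropy_iid_apply (hp : p ∈ stdSimplex ℝ (𝒳 × 𝒴)) (i : Fin n) {α : Type*}
    (φ : 𝒳 × 𝒴 → α) : entropy (iid p n) (fun ω => φ (ω i)) = entropy p φ := by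
  conv_rhs => rw [← pmfOf_iid_apply hp i, entropy_pmfOf]

lemma entropy_iid_comp (hp : p ∈ stdSimplex ℝ (𝒳 × 𝒴)) (n : ℕ) {α : Type*} (φ : 𝒳 × 𝒴 → α) :
    entropy (iid p n) (fun ω i => φ (ω i)) = n * entropy p φ := by
  have h1 (ω : Fin n → 𝒳 × 𝒴) : iid p n ω * Real.logb 2 (∏ i, pmfOf p φ (φ (ω i))) =
      ∑ i, iid p n ω * Real.logb 2 (pmfOf p φ (φ (ω i))) := by
    rw [← Finset.mul_sum]
    by_cases h0 : iid p n ω = 0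
    · simp [h0]
    rw [Real.logb_prod]
    intro i _
    have : p (ω i) ≠ 0 := fun h => h0 (Finset.prod_eq_zero (Finset.mem_univ i) h)
    exact (pmfOf_pos hp.1 φ ((hp.1 _).lt_of_ne this.symm)).ne'
  rw [entropy_eq_sum]
  simp_rw [pmfOf_iid_comp]
  rw [Finset.sum_congr rfl fun ω _ => h1 ω, Finset.sum_comm, ← Finset.sum_neg_distrib]
  rw [Finset.sum_congr rfl fun i _ => (show _ = entropy p φ from ?_)]
  · simp
  · rw [entropy_eq_sum, ← sum_pmfOf_mul (iid p n) (fun ω => ω i)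
      (fun z => Real.logb 2 (pmfOf p φ (φ z))), pmfOf_iid_apply hp]

/-- The first `m` drawings, as a sequence of length `n` whose later terms are `none`, so that the
type does not depend on `m`. -/
def past (m : ℕ) (ω : Fin n → 𝒳 × 𝒴) : Fin n → Option (𝒳 × 𝒴) :=
  fun i => if (i : ℕ) < m then some (ω i) else none

omit [Fintype 𝒳] [Fintype 𝒴] in
lemma past_eq_iff (m : ℕ) (ω ω' : Fin n → 𝒳 × 𝒴) :
    past m ω = past m ω' ↔ ∀ i : Fin n, (i : ℕ) < m → ω i = ω' i := by
  simp only [past, funext_iff]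
  refine forall_congr' fun i => ?_
  split_ifs with h <;> simp [h]

omit [Fintype 𝒳] [Fintype 𝒴] in
lemma past_succ_eq_iff (i : Fin n) (ω ω' : Fin n → 𝒳 × 𝒴) :
    past (i + 1) ω = past (i + 1) ω' ↔ past i ω = past i ω' ∧ ω i = ω' i := by
  simp only [past_eq_iff]
  refine ⟨fun h => ⟨fun j hj => h j (by omega), h i (by omega)⟩, fun h j hj => ?_⟩
  rcases Nat.lt_succ_iff_lt_or_eq.1 hj with h1 | h1
  · exact h.1 j h1
  · rw [Fin.ext h1]; exact h.2

/-- `∑ᵢ I(W, Zⁱ⁻¹ ; Zᵢ | φ(Zᵢ)) ≤ H(W | φ(Z₁), …, φ(Zₙ))` for a function `W` of `Zⁿ`. -/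
lemma sum_condMutualInfo_le (hp : p ∈ stdSimplex ℝ (𝒳 × 𝒴)) {α β : Type*}
    (W : (Fin n → 𝒳 × 𝒴) → β) (φ : 𝒳 × 𝒴 → α) :
    ∑ i : Fin n, (entropy p id - entropy p φ
        - entropy (iid p n) (fun ω => (ω i, W ω, past i ω))
        + entropy (iid p n) (fun ω => (φ (ω i), W ω, past i ω))) ≤
      entropy (iid p n) (fun ω => (W ω, fun i => φ (ω i))) -
        entropy (iid p n) (fun ω i => φ (ω i)) := by
  have hP := (iid_mem_stdSimplex hp n).1
  set T : ℕ → ℝ := fun m => entropy (iid p n) (fun ω => (W ω, past m ω, fun i => φ (ω i)))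
  have hstep (i : Fin n) : entropy p id - entropy p φ
        - entropy (iid p n) (fun ω => (ω i, W ω, past i ω))
        + entropy (iid p n) (fun ω => (φ (ω i), W ω, past i ω)) ≤
      (entropy p id - entropy p φ) - (T (i + 1) - T i) := by
    -- `H(Zᵢ | φ(Zᵢ), W, Zⁱ⁻¹)` does not increase when all of `φ(Z₁), …, φ(Zₙ)` are also given
    have h := entropy_submodular hP (fun ω => ω i) (fun ω i => φ (ω i))
      (fun ω => (φ (ω i), W ω, past i ω))
    have e1 : entropy (iid p n) (fun ω => (ω i, (fun i => φ (ω i)), φ (ω i), W ω, past i ω)) =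
        T (i + 1) := entropy_congr hP fun ω ω' _ _ => by
      simp only [Prod.mk.injEq, past_succ_eq_iff]
      constructor
      · tauto
      · rintro ⟨h1, ⟨h2, h3⟩, h4⟩
        exact ⟨h3, h4, by rw [h3], h1, h2⟩
    have e2 : entropy (iid p n) (fun ω => (ω i, φ (ω i), W ω, past i ω)) =
        entropy (iid p n) (fun ω => (ω i, W ω, past i ω)) := entropy_congr hP fun ω ω' _ _ => by
      simp only [Prod.mk.injEq]
      exact ⟨fun h => ⟨h.1, h.2.2⟩, fun h => ⟨h.1, by rw [h.1], h.2⟩⟩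
    have e3 : entropy (iid p n) (fun ω => ((fun i => φ (ω i)), φ (ω i), W ω, past i ω)) =
        T i := entropy_congr hP fun ω ω' _ _ => by
      simp only [Prod.mk.injEq]
      exact ⟨fun h => ⟨h.2.2.1, h.2.2.2, h.1⟩, fun h => ⟨h.2.2, congrFun h.2.2 i, h.1, h.2.1⟩⟩
    rw [e1, e2, e3] at h
    linarith
  refine (Finset.sum_le_sum fun i _ => hstep i).trans ?_
  rw [Finset.sum_sub_distrib, Fin.sum_univ_eq_sum_range (fun i => T (i + 1) - T i) n,
    Finset.sum_range_sub, Finset.sum_const, Finset.card_univ, Fintype.card_fin, nsmul_eq_mul,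
    mul_sub]
  have h1 : (n : ℝ) * entropy p id ≤ T n := by
    rw [← entropy_iid_comp hp n id]
    refine entropy_le_entropy hP fun ω ω' _ _ h => ?_
    simp only [Prod.mk.injEq, past_eq_iff] at h
    exact funext fun i => h.2.1 i i.2
  have h2 : T 0 = entropy (iid p n) (fun ω => (W ω, fun i => φ (ω i))) :=
    entropy_congr hP fun ω ω' _ _ => by
      simp [past_eq_iff]
  rw [h2, entropy_iid_comp hp n φ]
  linarith

/-- `H(W) - n H(φ(Z)) ≤ ∑ᵢ I(W, Zⁱ⁻¹ ; Zᵢ | φ(Zᵢ))` for a function `W` of `Zⁿ`. -/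
lemma le_sum_condMutualInfo (hp : p ∈ stdSimplex ℝ (𝒳 × 𝒴)) {α β : Type*}
    (W : (Fin n → 𝒳 × 𝒴) → β) (φ : 𝒳 × 𝒴 → α) :
    entropy (iid p n) W - n * entropy p φ ≤
    ∑ i : Fin n, (entropy p id - entropy p φ
        - entropy (iid p n) (fun ω => (ω i, W ω, past i ω))
        + entropy (iid p n) (fun ω => (φ (ω i), W ω, past i ω))) := by
  have hP := (iid_mem_stdSimplex hp n).1
  set T : ℕ → ℝ := fun m => entropy (iid p n) (fun ω => (W ω, past m ω))
  have hstep (i : Fin n) : (entropy p id - entropy p φ) - (T (i + 1) - T i) ≤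
      entropy p id - entropy p φ
        - entropy (iid p n) (fun ω => (ω i, W ω, past i ω))
        + entropy (iid p n) (fun ω => (φ (ω i), W ω, past i ω)) := by
    have e1 : entropy (iid p n) (fun ω => (ω i, W ω, past i ω)) = T (i + 1) :=
      entropy_congr hP fun ω ω' _ _ => by
        simp only [Prod.mk.injEq, past_succ_eq_iff]
        tauto
    have e2 : T i ≤ entropy (iid p n) (fun ω => (φ (ω i), W ω, past i ω)) :=
      entropy_le_entropy hP fun ω ω' _ _ h => by
        simp only [Prod.mk.injEq] at h ⊢
        exact h.2
    rw [e1]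
    linarith
  refine le_trans ?_ (Finset.sum_le_sum fun i _ => hstep i)
  rw [Finset.sum_sub_distrib, Fin.sum_univ_eq_sum_range (fun i => T (i + 1) - T i) n,
    Finset.sum_range_sub, Finset.sum_const, Finset.card_univ, Fintype.card_fin, nsmul_eq_mul,
    mul_sub]
  have h1 : T n ≤ (n : ℝ) * entropy p id := by
    rw [← entropy_iid_comp hp n id]
    refine entropy_le_entropy hP fun ω ω' _ _ h => ?_
    have : ω = ω' := h
    rw [this]
  have h2 : T 0 = entropy (iid p n) W :=
    entropy_congr hP fun ω ω' _ _ => by simp [past_eq_iff]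
  rw [h2]
  linarith

/-- The converse in terms of entropies: a function `W` of `(Xⁿ, Yⁿ)` that is almost determined by
`Xⁿ` and almost determined by `Yⁿ` has entropy rate at most about `H(K)`. -/
lemma entropy_le_of_condDiv_le (hp : p ∈ stdSimplex ℝ (𝒳 × 𝒴)) {η C : ℝ} (hC : 0 ≤ C)
    (h : ∀ s : 𝒳 × 𝒴 → ℝ, (∀ z, 0 ≤ s z) → (∀ z, p z = 0 → s z = 0) →
      condDiv p (componentX p) s ≤
        η * ∑ z, s z + C * (condDiv p Prod.fst s + condDiv p Prod.snd s))
    {β : Type*} (W : (Fin n → 𝒳 × 𝒴) → β) :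
    entropy (iid p n) W ≤ n * (entropy p (componentX p) + η) +
      C * (condEntropy (iid p n) W seqX + condEntropy (iid p n) W seqY) := by
  have hP := iid_mem_stdSimplex hp n
  have h0 := le_sum_condMutualInfo hp W (componentX p)
  have h1 := sum_condMutualInfo_le hp W Prod.fst
  have h2 := sum_condMutualInfo_le hp W Prod.snd
  have h3 := Finset.sum_le_sum fun (i : Fin n) (_ : i ∈ Finset.univ) =>
    condMutualInfo_component_le h hP (pmfOf_iid_apply hp i) (fun ω => (W ω, past i ω))
  have e0 (i : Fin n) : entropy (iid p n) (fun ω => ω i) = entropy p id :=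
    entropy_iid_apply hp i id
  have e1 (i : Fin n) : entropy (iid p n) (fun ω => (ω i).1) = entropy p Prod.fst :=
    entropy_iid_apply hp i Prod.fst
  have e2 (i : Fin n) : entropy (iid p n) (fun ω => (ω i).2) = entropy p Prod.snd :=
    entropy_iid_apply hp i Prod.snd
  simp only [e0, e1, e2, fun i : Fin n => entropy_iid_apply hp i (componentX p)] at h3
  replace h3 := h0.trans h3
  rw [Finset.sum_add_distrib, ← Finset.mul_sum, Finset.sum_add_distrib, Finset.sum_const,
    Finset.card_univ, Fintype.card_fin, nsmul_eq_mul] at h3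
  have h4 := mul_le_mul_of_nonneg_left (add_le_add h1 h2) hC
  have h5 := h3.trans (add_le_add_right h4 _)
  simp only [condEntropy]
  change _ ≤ (n : ℝ) * η + C * (entropy (iid p n) (fun ω => (W ω, seqX ω)) -
    entropy (iid p n) seqX + (entropy (iid p n) (fun ω => (W ω, seqY ω)) -
    entropy (iid p n) seqY)) at h5
  linarith

end Block

/-! ### Cardinality bounds and Fano's inequality -/

section Fano

/-- The uniform distribution maximises the entropy of weights with a given total mass. -/
lemma sum_negMulLog_le {ι : Type*} (T : Finset ι) {q : ι → ℝ} (hq : ∀ i ∈ T, 0 ≤ q i) :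
    ∑ i ∈ T, (q i).negMulLog ≤ (∑ i ∈ T, q i).negMulLog + (∑ i ∈ T, q i) * Real.log T.card := by
  set m := ∑ i ∈ T, q i with hm
  rcases (Finset.sum_nonneg hq).eq_or_lt with h0 | h0
  · rw [← hm] at h0
    have hz := (Finset.sum_eq_zero_iff_of_nonneg hq).1 (hm.symm.trans h0.symm)
    rw [Finset.sum_eq_zero fun i hi => by rw [hz i hi, Real.negMulLog_zero], ← h0]
    simp
  rw [← hm] at h0
  have hN : 0 < (T.card : ℝ) := by
    rcases T.eq_empty_or_nonempty with h | h
    · simp [hm, h] at h0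
    · exact_mod_cast h.card_pos
  have hterm : ∀ i ∈ T, (q i).negMulLog ≤ -(q i * Real.log (m / T.card)) + (m / T.card - q i) := by
    intro i hi
    rcases (hq i hi).eq_or_lt with h | h
    · rw [← h]; simp; positivity
    have h1 := Real.log_le_sub_one_of_pos (show 0 < m / T.card / q i by positivity)
    rw [Real.log_div (by positivity) h.ne'] at h1
    have h2 := mul_le_mul_of_nonneg_left h1 h.le
    have h3 : q i * (m / T.card / q i - 1) = m / T.card - q i := by field_simp
    rw [Real.negMulLog]
    linarith
  refine (Finset.sum_le_sum hterm).trans_eq ?_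
  rw [Finset.sum_add_distrib, Finset.sum_neg_distrib, ← Finset.sum_mul, Finset.sum_sub_distrib,
    ← hm, Finset.sum_const, nsmul_eq_mul, Real.log_div h0.ne' hN.ne', Real.negMulLog]
  field_simp
  ring

variable {Ω α : Type*} [Fintype Ω] {P : Ω → ℝ}

lemma entropy_mul_log_two [DecidableEq α] (Z : Ω → α) :
    entropy P Z * Real.log 2 = ∑ z ∈ Finset.univ.image Z, (pmfOf P Z z).negMulLog := by
  have h := sum_image_pmfOf_mul P Z fun z => -Real.log (pmfOf P Z z)
  simp only [mul_neg, ← neg_mul] at h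
  have := (Real.log_pos one_lt_two).ne'
  simp only [Real.negMulLog, h, entropy_eq_sum, ← Finset.sum_neg_distrib, Finset.sum_mul,
    Real.logb]
  exact Finset.sum_congr rfl fun ω _ => by field_simp

lemma entropy_le_logb_card (hP : P ∈ stdSimplex ℝ Ω) [Fintype α] (Z : Ω → α) :
    entropy P Z ≤ Real.logb 2 (Fintype.card α) := by
  classical
  have h := sum_negMulLog_le (Finset.univ.image Z) fun z _ => pmfOf_nonneg hP.1 Z z
  have h1 : ∑ z ∈ Finset.univ.image Z, pmfOf P Z z = 1 := by
    simpa [hP.2] using sum_image_pmfOf_mul P Z fun _ => 1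
  have hne : (Finset.univ.image Z).Nonempty := by
    by_contra h0
    rw [Finset.not_nonempty_iff_eq_empty] at h0
    simp [h0] at h1
  rw [Real.logb, le_div_iff₀ (Real.log_pos one_lt_two), entropy_mul_log_two]
  rw [h1, Real.negMulLog_one, zero_add, one_mul] at h
  refine h.trans (Real.log_le_log (by exact_mod_cast hne.card_pos) ?_)
  exact_mod_cast Finset.card_le_univ _

/-- A variable that equals `none` except with probability `e`, and takes at most `N` further
values, has entropy at most `h(e) + e log N`. -/
lemma entropy_option_le (hP : P ∈ stdSimplex ℝ Ω) (V : Ω → Option α) {N : ℝ}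
    (hN1 : 1 ≤ N)
    (hN : ∀ T : Finset α, (∀ a ∈ T, ∃ ω, V ω = some a) → (T.card : ℝ) ≤ N) :
    entropy P V * Real.log 2 ≤
      Real.binEntropy (prob P {ω | V ω ≠ none}) + prob P {ω | V ω ≠ none} * Real.log N := by
  classical
  set e := prob P {ω | V ω ≠ none}
  have he0 : 0 ≤ e := Finset.sum_nonneg fun ω _ => hP.1 ω
  have hnone : pmfOf P V none = 1 - e := by
    rw [eq_sub_iff_add_eq, ← hP.2]
    simp only [pmfOf, e, prob, Set.mem_ofPred_eq]
    exact Finset.sum_filter_add_sum_filter_not _ _ _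
  have hsome : ∑ v ∈ (Finset.univ.image V).erase none, pmfOf P V v = e := by
    have h := sum_image_pmfOf_mul P V fun v => if v = none then 0 else 1
    simp only [mul_ite, mul_zero, mul_one] at h
    rw [← Finset.filter_ne', Finset.sum_filter]
    simp only [ne_eq, ite_not]
    rw [h]
    simp only [e, prob, Finset.sum_filter, Set.mem_ofPred_eq, ne_eq, ite_not]
  have hcard : (((Finset.univ.image V).erase none).card : ℝ) ≤ N := by
    have h := hN (Finset.univ.image V).eraseNone (fun a ha => by
      simpa using ha)
    rwa [Finset.card_eraseNone_eq_card_erase] at h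
  have hsum : ∑ v ∈ Finset.univ.image V, (pmfOf P V v).negMulLog = (1 - e).negMulLog +
      ∑ v ∈ (Finset.univ.image V).erase none, (pmfOf P V v).negMulLog := by
    by_cases h : none ∈ Finset.univ.image V
    · rw [← hnone, Finset.add_sum_erase _ (fun v => (pmfOf P V v).negMulLog) h]
    · have h0 : pmfOf P V none = 0 := by
        rw [pmfOf_eq_sum]
        refine Finset.sum_eq_zero fun ω _ => if_neg fun h' => h ?_
        exact Finset.mem_image.2 ⟨ω, Finset.mem_univ _, h'⟩
      rw [← hnone, h0, Finset.erase_eq_of_notMem h]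
      simp
  rw [entropy_mul_log_two, hsum, Real.binEntropy_eq_negMulLog_add_negMulLog_one_sub]
  have h := sum_negMulLog_le ((Finset.univ.image V).erase none) fun v _ => pmfOf_nonneg hP.1 V v
  rw [hsome] at h
  have h2 : Real.log (((Finset.univ.image V).erase none).card : ℝ) ≤ Real.log N := by
    rcases Nat.eq_zero_or_pos ((Finset.univ.image V).erase none).card with h3 | h3
    · rw [h3]; simpa using Real.log_nonneg hN1
    · exact Real.log_le_log (by exact_mod_cast h3) hcard
  have := mul_le_mul_of_nonneg_left h2 he0
  linarith

end Fano

/-! ### Schemes with low link rates -/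

section Converse

variable {𝒳 : Type u} {𝒴 : Type v} [Fintype 𝒳] [Fintype 𝒴] {p : 𝒳 × 𝒴 → ℝ} {n M₁ M₂ : ℕ}

lemma condEntropy_out₁_seqX_le (hp : p ∈ stdSimplex ℝ (𝒳 × 𝒴)) (c : Scheme 𝒳 𝒴 n M₁ M₂) :
    condEntropy (iid p n) c.out₁ seqX ≤ Real.logb 2 M₁ := by
  have hP := iid_mem_stdSimplex hp n
  have h1 : entropy (iid p n) (fun ω => (c.out₁ ω, seqX ω)) ≤
      entropy (iid p n) (fun ω => (c.f₁ (seqX ω) (seqY ω), seqX ω)) :=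
    entropy_le_entropy hP.1 fun ω ω' _ _ h => by
      simp only [Prod.mk.injEq] at h ⊢
      exact ⟨by rw [Scheme.out₁, Scheme.out₁, h.1, h.2], h.2⟩
  have h2 := entropy_pair_le hP (fun ω => c.f₁ (seqX ω) (seqY ω)) seqX
  have h3 := entropy_le_logb_card hP (fun ω => c.f₁ (seqX ω) (seqY ω))
  rw [Fintype.card_fin] at h3
  rw [condEntropy]
  linarith

/-- Fano's inequality for the output of the first observer, given the observation and the message
of the second. -/
lemma condEntropy_out₁_seqY_le (hp : p ∈ stdSimplex ℝ (𝒳 × 𝒴)) (hM : 0 < M₁) [Nonempty 𝒳]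
    (c : Scheme 𝒳 𝒴 n M₁ M₂) :
    condEntropy (iid p n) c.out₁ seqY ≤ Real.logb 2 M₂ +
      (Real.binEntropy (prob (iid p n) {ω | c.out₁ ω ≠ c.out₂ ω}) / Real.log 2 +
        prob (iid p n) {ω | c.out₁ ω ≠ c.out₂ ω} *
          (n * Real.logb 2 (Fintype.card 𝒳) + Real.logb 2 M₁)) := by
  classical
  have hP := iid_mem_stdSimplex hp n
  -- `V` is the output where the observers disagree, and `none` where they agree, so that the
  -- first output is a function of `V`, the second message and the second observation
  set V : (Fin n → 𝒳 × 𝒴) → Option ℤ :=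
    fun ω => if c.out₁ ω = c.out₂ ω then none else some (c.out₁ ω) with hV
  have hVne : {ω | V ω ≠ none} = {ω | c.out₁ ω ≠ c.out₂ ω} := by
    ext ω; simp [hV]
  have hX : 0 < Fintype.card 𝒳 := Fintype.card_pos
  have h0 := entropy_option_le hP V (N := ((Fintype.card 𝒳 ^ n * M₁ : ℕ) : ℝ))
    (by exact_mod_cast Nat.one_le_iff_ne_zero.2 (by positivity)) (fun T hT => by
      have hsub : T ⊆ Finset.univ.image (fun x : (Fin n → 𝒳) × Fin M₁ => c.g₁ x.1 x.2) := by
        intro a ha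
        obtain ⟨ω, hω⟩ := hT a ha
        have : c.out₁ ω = a := by
          simp only [hV] at hω
          split_ifs at hω
          exact Option.some.inj hω
        exact Finset.mem_image.2 ⟨(seqX ω, c.f₁ (seqX ω) (seqY ω)), Finset.mem_univ _, this⟩
      have h := (Finset.card_le_card hsub).trans Finset.card_image_le
      simp only [Finset.card_univ, Fintype.card_prod, Fintype.card_fun, Fintype.card_fin] at h
      exact_mod_cast h)
  rw [hVne] at h0
  have h1 : entropy (iid p n) (fun ω => (c.out₁ ω, seqY ω)) ≤
      entropy (iid p n) (fun ω => (c.f₂ (seqX ω) (seqY ω), V ω, seqY ω)) :=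
    entropy_le_entropy hP.1 fun ω ω' _ _ h => by
      simp only [Prod.mk.injEq] at h ⊢
      refine ⟨?_, h.2.2⟩
      have h2 : c.out₂ ω = c.out₂ ω' := by rw [Scheme.out₂, Scheme.out₂, h.1, h.2.2]
      have h3 := h.2.1
      simp only [hV] at h3
      split_ifs at h3 with h4 h5 h5
      · rw [h4, h5, h2]
      · exact Option.some.inj h3
  have h2 := entropy_pair_le hP (fun ω => c.f₂ (seqX ω) (seqY ω)) (fun ω => (V ω, seqY ω))
  have h3 := entropy_le_logb_card hP (fun ω => c.f₂ (seqX ω) (seqY ω))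
  have h4 := entropy_pair_le hP V seqY
  rw [Fintype.card_fin] at h3
  have h5 := (le_div_iff₀ (Real.log_pos one_lt_two)).2 h0
  push_cast at h5
  rw [Real.log_mul (by positivity) (by positivity), Real.log_pow, add_div, mul_div_assoc,
    add_div, mul_div_assoc] at h5
  simp only [Real.logb] at h3 ⊢
  rw [condEntropy]
  linarith

/-- The zero-rate converse: with links of low rate and a low probability of disagreement, the
entropy rate of the common output is at most about `H(K)`. -/
lemma exists_entropy_out₁_le (hp : p ∈ stdSimplex ℝ (𝒳 × 𝒴)) {η : ℝ} (hη : 0 < η) :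
    ∃ δ : ℝ, 0 < δ ∧ δ ≤ η ∧ ∀ n M₁ M₂ : ℕ, 0 < n → Real.logb 2 M₁ ≤ n * δ →
      Real.logb 2 M₂ ≤ n * δ → ∀ c : Scheme 𝒳 𝒴 n M₁ M₂,
      prob (iid p n) {ω | c.out₁ ω ≠ c.out₂ ω} ≤ δ →
      entropy (iid p n) c.out₁ ≤ n * (entropy p (componentX p) + η) := by
  obtain ⟨C, hC, hdiv⟩ := exists_condDiv_component_le hp.1 (half_pos hη)
  have hne : Nonempty (𝒳 × 𝒴) := by
    by_contra h
    rw [not_nonempty_iff] at h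
    simpa using hp.2
  obtain ⟨x₀, y₀⟩ := hne
  have hneX : Nonempty 𝒳 := ⟨x₀⟩
  set L := Real.logb 2 (Fintype.card 𝒳) with hL
  have hL0 : 0 ≤ L :=
    Real.logb_nonneg one_lt_two (by exact_mod_cast Fintype.card_pos (α := 𝒳))
  have hlim1 : ∀ᶠ e in nhds (0 : ℝ), C * (Real.binEntropy e / Real.log 2) < η / 4 := by
    have : Continuous fun e => C * (Real.binEntropy e / Real.log 2) :=
      continuous_const.mul (Real.binEntropy_continuous.div_const _)
    exact this.tendsto' 0 0 (by simp) |>.eventually_lt_const (by positivity)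
  have hlim2 : ∀ᶠ e in nhds (0 : ℝ), C * (2 * e + e * (L + e)) < η / 4 := by
    have : Continuous fun e => C * (2 * e + e * (L + e)) := by fun_prop
    exact this.tendsto' 0 0 (by simp) |>.eventually_lt_const (by positivity)
  obtain ⟨r, hr, hball⟩ := Metric.eventually_nhds_iff.1 (hlim1.and hlim2)
  refine ⟨min (r / 2) η, by positivity, min_le_right _ _, fun n M₁ M₂ hn h1 h2 c he => ?_⟩
  set δ := min (r / 2) η with hδ
  have hδ0 : 0 < δ := by positivity
  have hδr : δ < r := (min_le_left _ _).trans_lt (half_lt_self hr)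
  set e := prob (iid p n) {ω | c.out₁ ω ≠ c.out₂ ω} with he'
  have he0 : 0 ≤ e := Finset.sum_nonneg fun ω _ => (iid_mem_stdSimplex hp n).1 ω
  have hM : 0 < M₁ := (c.f₁ (fun _ => x₀) (fun _ => y₀)).pos
  have hn1 : (1 : ℝ) ≤ n := by exact_mod_cast hn
  have b1 := (hball (y := e) (by rw [Real.dist_eq, sub_zero, abs_of_nonneg he0]; linarith)).1
  have b2 := (hball (y := δ) (by rw [Real.dist_eq, sub_zero, abs_of_pos hδ0]; linarith)).2
  have a1 := condEntropy_out₁_seqX_le hp c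
  have a2 := condEntropy_out₁_seqY_le hp hM c
  have a3 := entropy_le_of_condDiv_le hp hC hdiv c.out₁
  have a4 : e * (n * L + Real.logb 2 M₁) ≤ n * (δ * (L + δ)) := by
    calc e * (n * L + Real.logb 2 M₁) ≤ e * (n * L + n * δ) := by gcongr
      _ ≤ δ * (n * L + n * δ) := by gcongr
      _ = n * (δ * (L + δ)) := by ring
  have a5 : C * (condEntropy (iid p n) c.out₁ seqX + condEntropy (iid p n) c.out₁ seqY) ≤
      C * (Real.binEntropy e / Real.log 2 + n * (2 * δ + δ * (L + δ))) :=
    mul_le_mul_of_nonneg_left (by linarith) hC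
  -- the block length is at least one, so the constant from Fano's inequality counts as a rate
  have a6 : C * (Real.binEntropy e / Real.log 2) ≤ n * (η / 4) :=
    b1.le.trans (le_mul_of_one_le_left (by positivity) hn1)
  have a7 := mul_le_mul_of_nonneg_left b2.le (Nat.cast_nonneg (α := ℝ) n)
  linarith

end Converse

/-! ### Rate regions at zero link rates -/

section ZeroRate

variable {𝒳 : Type u} {𝒴 : Type v} [Fintype 𝒳] [Fintype 𝒴] {p : 𝒳 × 𝒴 → ℝ} {n : ℕ}

lemma logb_numMessages_le (n : ℕ) {R δ : ℝ} (hδ : 0 ≤ δ) (hR : R ≤ δ) :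
    Real.logb 2 (numMessages n R) ≤ n * δ := by
  -- for negative `R` there may be no message at all, and then `logb 2 0 = 0`
  rcases Nat.eq_zero_or_pos (numMessages n R) with h | h
  · rw [h]; simp; positivity
  have h1 : (numMessages n R : ℝ) ≤ 2 ^ ((n : ℝ) * R) := Nat.floor_le (by positivity)
  refine (Real.logb_le_logb_of_le one_lt_two (by exact_mod_cast h) h1).trans ?_
  rw [Real.logb_rpow two_pos (by norm_num)]
  gcongr

lemma numMessages_pos (n : ℕ) {R : ℝ} (hR : 0 ≤ R) : 0 < numMessages n R :=
  Nat.floor_pos.2 (Real.one_le_rpow one_le_two (by positivity))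

/-- A scheme in which the genie stays silent. -/
def silentScheme {M₁ M₂ : ℕ} (h₁ : 0 < M₁) (h₂ : 0 < M₂) (g₁ : (Fin n → 𝒳) → ℤ)
    (g₂ : (Fin n → 𝒴) → ℤ) : Scheme 𝒳 𝒴 n M₁ M₂ where
  f₁ _ _ := ⟨0, h₁⟩
  f₂ _ _ := ⟨0, h₂⟩
  g₁ x _ := g₁ x
  g₂ y _ := g₂ y

lemma mutualInfo_seq_eq_entropy (hp : p ∈ stdSimplex ℝ (𝒳 × 𝒴)) (W : (Fin n → 𝒳 × 𝒴) → ℤ) :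
    mutualInfo (iid p n) (fun ω => (seqX ω, seqY ω)) W = entropy (iid p n) W := by
  have h : entropy (iid p n) (fun ω => ((seqX ω, seqY ω), W ω)) =
      entropy (iid p n) (fun ω => (seqX ω, seqY ω)) :=
    entropy_congr (iid_mem_stdSimplex hp n).1 fun ω ω' _ _ => by
      simp only [Prod.mk.injEq, and_iff_left_iff_imp]
      rintro ⟨h1, h2⟩
      rw [show ω = ω' from funext fun i => Prod.ext (congrFun h1 i) (congrFun h2 i)]
  rw [mutualInfo, condEntropy, h]
  ring

/-- `I(Xⁿ ; Yⁿ | W) ≥ n I(X ; Y) - H(W)` for a function `W` of `(Xⁿ, Yⁿ)`. -/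
lemma le_condMutualInfo_seq (hp : p ∈ stdSimplex ℝ (𝒳 × 𝒴)) (W : (Fin n → 𝒳 × 𝒴) → ℤ) :
    n * mutualInfo p Prod.fst Prod.snd - entropy (iid p n) W ≤
      condMutualInfo (iid p n) seqX seqY W := by
  have hP := (iid_mem_stdSimplex hp n).1
  have h1 : entropy (iid p n) seqX ≤ entropy (iid p n) (fun ω => (seqX ω, W ω)) :=
    entropy_le_entropy hP fun ω ω' _ _ h => congrArg Prod.fst h
  have h2 : entropy (iid p n) seqY ≤ entropy (iid p n) (fun ω => (seqY ω, W ω)) :=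
    entropy_le_entropy hP fun ω ω' _ _ h => congrArg Prod.fst h
  have h3 : entropy (iid p n) (fun ω => (seqX ω, seqY ω, W ω)) ≤
      entropy (iid p n) (fun ω i => id (ω i)) :=
    entropy_le_entropy hP fun ω ω' _ _ h => by
      have : ω = ω' := h
      rw [this]
  have e1 : entropy (iid p n) seqX = n * entropy p Prod.fst := entropy_iid_comp hp n Prod.fst
  have e2 : entropy (iid p n) seqY = n * entropy p Prod.snd := entropy_iid_comp hp n Prod.snd
  rw [entropy_iid_comp hp] at h3
  have h4 : n * mutualInfo p Prod.fst Prod.snd =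
      n * entropy p Prod.fst - n * entropy p id + n * entropy p Prod.snd := by
    rw [mutualInfo, condEntropy]
    change n * (_ - (entropy p id - _)) = _
    ring
  rw [h4, condMutualInfo, condEntropy, condEntropy]
  linarith

/-- `I(X ; Y | K) = I(X ; Y) - H(K)`, as `K` is a function of `X` and of `Y`. -/
lemma condMutualInfo_component (hp : ∀ z, 0 ≤ p z) :
    condMutualInfo p Prod.fst Prod.snd (componentX p) =
      mutualInfo p Prod.fst Prod.snd - entropy p (componentX p) := by
  have h1 : entropy p (fun ω => (ω.1, componentX p ω)) = entropy p Prod.fst :=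
    entropy_congr hp fun ω ω' _ _ => by
      simp only [Prod.mk.injEq, and_iff_left_iff_imp, componentX]
      exact fun h => by rw [h]
  have h2 : entropy p (fun ω => (ω.2, componentX p ω)) = entropy p Prod.snd :=
    entropy_congr hp fun ω ω' h h' => by
      rw [componentX_eq_componentY p h, componentX_eq_componentY p h']
      simp only [Prod.mk.injEq, and_iff_left_iff_imp, componentY]
      exact fun h => by rw [h]
  have h3 : entropy p (fun ω => (ω.1, ω.2, componentX p ω)) = entropy p (fun ω => (ω.1, ω.2)) :=
    entropy_congr hp fun ω ω' _ _ => by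
      simp only [Prod.mk.injEq, componentX]
      exact ⟨fun h => ⟨h.1, h.2.1⟩, fun h => ⟨h.1, h.2, by rw [h.1]⟩⟩
  simp only [condMutualInfo, mutualInfo, condEntropy, h1, h2, h3]
  ring

/-- Membership in the closure gives link rates below `δ / 2`, and the slack in the number of
messages adds another `δ / 2`. -/
lemma le_of_mem_zeroRateCISet (hp : p ∈ stdSimplex ℝ (𝒳 × 𝒴)) {R : ℝ}
    (hR : R ∈ zeroRateCISet p) : R ≤ entropy p (componentX p) := by
  refine le_of_forall_pos_le_add fun ε hε => ?_
  obtain ⟨δ, hδ, hδη, h⟩ := exists_entropy_out₁_le hp (half_pos hε)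
  obtain ⟨r, hr, hdist⟩ := Metric.mem_closure_iff.1 hR (δ / 2) (half_pos hδ)
  obtain ⟨n, hn, c, h1, h2⟩ := hr (δ / 2) (half_pos hδ)
  rw [Prod.dist_eq, max_lt_iff, Real.dist_eq, Real.dist_eq, zero_sub, zero_sub, abs_neg, abs_neg]
    at hdist
  have h3 := h n _ _ hn (logb_numMessages_le n hδ.le (by linarith [le_abs_self r.1]))
    (logb_numMessages_le n hδ.le (by linarith [le_abs_self r.2])) c (by linarith)
  have hn0 : (0 : ℝ) < n := by exact_mod_cast hn
  rw [mutualInfo_seq_eq_entropy hp, one_div, inv_mul_eq_div, le_div_iff₀ hn0, mul_comm] at h2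
  linarith [le_of_mul_le_mul_left (h2.trans h3) hn0]

/-- The bound for the residual dependency follows from the one for the common information, by
`I(Xⁿ ; Yⁿ | W) ≥ n I(X ; Y) - H(W)`. -/
lemma le_of_mem_zeroRateRDSet (hp : p ∈ stdSimplex ℝ (𝒳 × 𝒴)) {R : ℝ}
    (hR : R ∈ zeroRateRDSet p) : condMutualInfo p Prod.fst Prod.snd (componentX p) ≤ R := by
  refine le_of_forall_pos_le_add fun ε hε => ?_
  obtain ⟨δ, hδ, hδη, h⟩ := exists_entropy_out₁_le hp (half_pos hε)
  obtain ⟨r, hr, hdist⟩ := Metric.mem_closure_iff.1 hR (δ / 2) (half_pos hδ)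
  obtain ⟨n, hn, c, h1, h2⟩ := hr (δ / 2) (half_pos hδ)
  rw [Prod.dist_eq, max_lt_iff, Real.dist_eq, Real.dist_eq, zero_sub, zero_sub, abs_neg, abs_neg]
    at hdist
  have h3 := h n _ _ hn (logb_numMessages_le n hδ.le (by linarith [le_abs_self r.1]))
    (logb_numMessages_le n hδ.le (by linarith [le_abs_self r.2])) c (by linarith)
  have hn0 : (0 : ℝ) < n := by exact_mod_cast hn
  have h4 := le_condMutualInfo_seq hp c.out₁
  rw [one_div, inv_mul_eq_div, div_le_iff₀ hn0, mul_comm] at h2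
  have h5 : (n : ℝ) * (mutualInfo p Prod.fst Prod.snd) ≤
      n * (R + δ / 2 + (entropy p (componentX p) + ε / 2)) := by linarith
  rw [condMutualInfo_component hp.1]
  linarith [le_of_mul_le_mul_left h5 hn0]

lemma GKAchievable.mem_zeroRateCISet (hp : p ∈ stdSimplex ℝ (𝒳 × 𝒴)) {R : ℝ}
    (hR : GKAchievable p R) : R ∈ zeroRateCISet p := by
  refine subset_closure fun ε hε => ?_
  obtain ⟨n, hn, g₁, g₂, h1, h2⟩ := hR ε hε
  have hpos : 0 ≤ (0 : ℝ) + ε := by linarith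
  refine ⟨n, hn, silentScheme (numMessages_pos n hpos) (numMessages_pos n hpos) g₁ g₂, h1, ?_⟩
  rw [mutualInfo_seq_eq_entropy hp]
  exact h2

/-- Entropies for a single drawing are those of `p`. -/
lemma entropy_iid_one (hp : p ∈ stdSimplex ℝ (𝒳 × 𝒴)) {α β : Type*}
    {A : (Fin 1 → 𝒳 × 𝒴) → α} {φ : 𝒳 × 𝒴 → β}
    (h : ∀ ω ω', A ω = A ω' ↔ φ (ω 0) = φ (ω' 0)) : entropy (iid p 1) A = entropy p φ := by
  rw [← entropy_iid_apply hp (0 : Fin 1) φ]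
  exact entropy_congr (iid_mem_stdSimplex hp 1).1 fun ω ω' _ _ => h ω ω'

/-- With block length one and no genie, both observers can output the connected component. -/
lemma exists_component_labels (hp : p ∈ stdSimplex ℝ (𝒳 × 𝒴)) :
    ∃ (g₁ : (Fin 1 → 𝒳) → ℤ) (g₂ : (Fin 1 → 𝒴) → ℤ),
      prob (iid p 1) {ω | g₁ (seqX ω) ≠ g₂ (seqY ω)} = 0 ∧
      ∀ ω ω', g₁ (seqX ω) = g₁ (seqX ω') ↔ componentX p (ω 0) = componentX p (ω' 0) := by
  have : Finite (supportGraph p).ConnectedComponent := Quot.finite _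
  obtain ⟨e, he⟩ := Countable.exists_injective_nat (supportGraph p).ConnectedComponent
  refine ⟨fun x => e ((supportGraph p).connectedComponentMk (Sum.inl (x 0))),
    fun y => e ((supportGraph p).connectedComponentMk (Sum.inr (y 0))), ?_, fun ω ω' => ?_⟩
  · refine Finset.sum_eq_zero fun ω hω => ?_
    simp only [Finset.mem_filter, Finset.mem_univ, true_and, Set.mem_ofPred_eq] at hω
    by_contra h0
    have hpos : 0 < p (ω 0) := (hp.1 _).lt_of_ne fun h => h0 (by simp [iid, ← h])
    exact hω (congrArg (fun k => (e k : ℤ)) (componentX_eq_componentY p hpos))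
  · rw [Nat.cast_inj, he.eq_iff]
    rfl

lemma gkAchievable_entropy_component (hp : p ∈ stdSimplex ℝ (𝒳 × 𝒴)) :
    GKAchievable p (entropy p (componentX p)) := by
  obtain ⟨g₁, g₂, h1, h2⟩ := exists_component_labels hp
  refine fun ε hε => ⟨1, one_pos, g₁, g₂, h1.trans_le hε.le, ?_⟩
  rw [entropy_iid_one hp h2]
  simp [hε.le]

lemma condMutualInfo_mem_zeroRateRDSet (hp : p ∈ stdSimplex ℝ (𝒳 × 𝒴)) :
    condMutualInfo p Prod.fst Prod.snd (componentX p) ∈ zeroRateRDSet p := by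
  obtain ⟨g₁, g₂, h1, h2⟩ := exists_component_labels hp
  refine subset_closure fun ε hε => ?_
  have hpos : 0 ≤ (0 : ℝ) + ε := by linarith
  refine ⟨1, one_pos, silentScheme (numMessages_pos 1 hpos) (numMessages_pos 1 hpos) g₁ g₂,
    h1.trans_le hε.le, ?_⟩
  have hX (ω ω' : Fin 1 → 𝒳 × 𝒴) : seqX ω = seqX ω' ↔ (ω 0).1 = (ω' 0).1 := by
    simp [funext_iff, seqX]
  have hY (ω ω' : Fin 1 → 𝒳 × 𝒴) : seqY ω = seqY ω' ↔ (ω 0).2 = (ω' 0).2 := by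
    simp [funext_iff, seqY]
  have e1 : entropy (iid p 1) (fun ω => (seqX ω, g₁ (seqX ω))) =
      entropy p (fun ω => (ω.1, componentX p ω)) :=
    entropy_iid_one hp fun ω ω' => by simp only [Prod.mk.injEq, hX, h2]
  have e2 : entropy (iid p 1) (fun ω => (seqX ω, seqY ω, g₁ (seqX ω))) =
      entropy p (fun ω => (ω.1, ω.2, componentX p ω)) :=
    entropy_iid_one hp fun ω ω' => by simp only [Prod.mk.injEq, hX, hY, h2]
  have e3 : entropy (iid p 1) (fun ω => (seqY ω, g₁ (seqX ω))) =
      entropy p (fun ω => (ω.2, componentX p ω)) :=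
    entropy_iid_one hp fun ω ω' => by simp only [Prod.mk.injEq, hY, h2]
  have e4 : condMutualInfo (iid p 1) seqX seqY (fun ω => g₁ (seqX ω)) =
      condMutualInfo p Prod.fst Prod.snd (componentX p) := by
    simp only [condMutualInfo, condEntropy, e1, e2, e3, entropy_iid_one hp h2]
  change 1 / ((1 : ℕ) : ℝ) * condMutualInfo (iid p 1) seqX seqY (fun ω => g₁ (seqX ω)) ≤ _
  rw [e4]
  simp [hε.le]

end ZeroRate

/-! ### Common parts -/

section CommonPart

variable {𝒳 : Type u} {𝒴 : Type v} {p : 𝒳 × 𝒴 → ℝ}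

lemma isCommonPart_componentX (p : 𝒳 × 𝒴 → ℝ) : IsCommonPart p (componentX p) :=
  ⟨𝒳, 𝒴, Prod.fst, Prod.snd,
    ⟨⟨fun x => (x, (supportGraph p).connectedComponentMk (Sum.inl x)), fun _ _ => rfl⟩,
      Prod.fst, fun _ _ => rfl⟩,
    ⟨⟨fun y => (y, (supportGraph p).connectedComponentMk (Sum.inr y)),
      fun _ h => Prod.ext rfl (componentX_eq_componentY p h)⟩, Prod.fst, fun _ _ => rfl⟩⟩

/-- A common part is almost surely a function of `X` and of `Y`, hence of the component. -/
lemma IsCommonPart.entropy_le [Fintype 𝒳] [Fintype 𝒴] (hp : ∀ z, 0 ≤ p z) {γ : Type*}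
    {Q : 𝒳 × 𝒴 → γ} (hQ : IsCommonPart p Q) : entropy p Q ≤ entropy p (componentX p) := by
  obtain ⟨𝒳', 𝒴', X', Y', ⟨⟨e, he⟩, -⟩, ⟨⟨d, hd⟩, -⟩⟩ := hQ
  refine entropy_le_entropy hp fun ω ω' h h' hK => ?_
  have := eq_of_component_eq p (f := fun x => (e x).2) (g := fun y => (d y).2)
    (fun ω hω => (congrArg Prod.snd (he ω hω)).symm.trans (congrArg Prod.snd (hd ω hω))) hK
  exact (congrArg Prod.snd (he ω h)).trans (this.trans (congrArg Prod.snd (he ω' h')).symm)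

end CommonPart

end

end AssistedCI

open AssistedCI in
theorem mainTheorem2 {𝒳 : Type u} {𝒴 : Type v} [Fintype 𝒳] [Fintype 𝒴]
    (p : 𝒳 × 𝒴 → ℝ) (hp : p ∈ stdSimplex ℝ (𝒳 × 𝒴)) :
    -- the supremum and the infimum that define `R_CI-0` and `R_RD-0` are genuine
    IsLUB (zeroRateCISet p) (RCI0 p) ∧
    IsGLB (zeroRateRDSet p) (RRD0 p) ∧
    -- almost surely `X` and `Y` lie in the same connected component
    (∀ ω, 0 < p ω → componentX p ω = componentY p ω) ∧
    -- nontrivial behaviour only if there is a nontrivial explicit common part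
    (0 < RCI0 p ∨ RRD0 p < mutualInfo p Prod.fst Prod.snd →
      IsCommonPart p (componentX p) ∧ 0 < entropy p (componentX p)) ∧
    RCI0 p = entropy p (componentX p) ∧
    RRD0 p = condMutualInfo p Prod.fst Prod.snd (componentX p) ∧
    -- the theorem of Gács and Körner, where there is no genie
    IsLUB {R : ℝ | GKAchievable p R} (entropy p (componentX p)) ∧
    IsGreatest {h : ℝ | ∃ (γ : Type (max u v)) (Q : 𝒳 × 𝒴 → γ),
      IsCommonPart p Q ∧ h = entropy p Q} (entropy p (componentX p)) := by
  have hGK := gkAchievable_entropy_component hp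
  have hCI : IsGreatest (zeroRateCISet p) (entropy p (componentX p)) :=
    ⟨hGK.mem_zeroRateCISet hp, fun R hR => le_of_mem_zeroRateCISet hp hR⟩
  have hRD : IsLeast (zeroRateRDSet p) (condMutualInfo p Prod.fst Prod.snd (componentX p)) :=
    ⟨condMutualInfo_mem_zeroRateRDSet hp, fun R hR => le_of_mem_zeroRateRDSet hp hR⟩
  have hR1 : RCI0 p = entropy p (componentX p) := hCI.csSup_eq
  have hR2 : RRD0 p = condMutualInfo p Prod.fst Prod.snd (componentX p) := hRD.csInf_eq
  refine ⟨hR1 ▸ hCI.isLUB, hR2 ▸ hRD.isGLB, fun ω h => componentX_eq_componentY p h,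
    fun h => ⟨isCommonPart_componentX p, ?_⟩, hR1, hR2, ?_, ?_⟩
  · rw [hR1, hR2, condMutualInfo_component hp.1] at h
    rcases h with h | h <;> linarith
  · exact IsGreatest.isLUB ⟨hGK, fun R hR => hCI.2 (GKAchievable.mem_zeroRateCISet hp hR)⟩
  · refine ⟨⟨_, componentX p, isCommonPart_componentX p, rfl⟩, ?_⟩
    rintro h ⟨γ, Q, hQ, rfl⟩
    exact hQ.entropy_le hp.1
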